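/- Let $1\le m<n$ be integers, $U\subseteq\mathbf R^n$ open, and $\mathbf G(n,m)$ the Grassmannian of $m$-dimensional linear subspaces of $\mathbf R^n$, metrised by $\|P_S-P_T\|$, where $P_S$ is the orthogonal projection onto $S$. An $m$-dimensional varifold in $U$ is a Radon measure on $U\times\mathbf G(n,m)$; varifolds converge weakly, i.e. when tested against each function in $C_c(U\times\mathbf G(n,m))$; $\|V\|(A)=V(A\times\mathbf G(n,m))$. The same notions are used in $\mathbf R\times U\subseteq\mathbf R^{n+1}$. A varifold $V$ in $U$ is rectifiable if $V=\sum_i c_i\,\mathbf v_m(S_i)$ with $c_i>0$ and $S_i\subseteq U$ that are $\mathcal H^m$-measurable, countably $(\mathcal H^m,m)$-rectifiable and of locally finite $\mathcal H^m$-measure in $U$, where $\mathbf v_m(S)(A)=\mathcal H^m(\{x\in S:(x,\mathrm{Tan}^m(\mathcal H^m\llcorner S,x))\in A\})$ and $\mathrm{Tan}^m$ is the approximate tangent cone. The push-forward of $V$ under a $C^1$ map $f$ is $$(f_\#V)(\alpha)=\int_{\{\|\Lambda_m(Df(x)\circ P_S)\|>0\}}\alpha\bigl(f(x),Df(x)[S]\bigr)\,\|\Lambda_m(Df(x)\circ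 P_S)\|\,dV(x,S).$$ Let $V$ be an $m$-dimensional varifold in $U$ and let $\rho\in C^1(U,\mathbf R)$ be proper. For $\beta\in C_c(U\times\mathbf G(n,m-1))$ and Borel $B\subseteq\mathbf R$ put $$\mu_\beta(B)=\int_{\{\rho(x)\in B,\ \|D\rho(x)\circ P_S\|>0\}}\beta\bigl(x,S\cap\ker D\rho(x)\bigr)\,\|D\rho(x)\circ P_S\|\,dV(x,S).$$ The slice $\langle V,\rho,t\rangle$, if it exists, is the $(m-1)$-dimensional varifold in $U$ with $\langle V,\rho,t\rangle(\beta)=\lim_{r\downarrow0}\mu_\beta([t-r,t+r])/(2r)$ for all $\beta\in C_c(U\times\mathbf G(n,m-1))$; it exists for $\mathcal L^1$-almost every $t$. Put $|||W|||=\sup\{W(\beta):\beta\in C_c(U\times\mathbf G(n,m-1)),\ |\beta|\le1,\ \mathrm{Lip}\,\beta\le1\}$. A number $t$ is a Lebesgue point of $\langle V,\rho,\cdot\rangle$ if $\langle V,\rho,t\rangle$ exists and $\lim_{r\downarrow0}r^{-1}\int_{t-r}^{t+r}|||\langle V,\rho,s\rangle-\langle V,\rho,t\rangle|||\,ds=0$.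 For $\delta\in(0,1)$ let $s_\delta\in C^\infty(\mathbf R,\mathbf R)$ be any function with $s_\delta(\tau)=\tau$ for $\delta\le\tau\le1-\delta$, $s_\delta(\tau)=0$ for $\tau\le0$, $s_\delta(\tau)=1$ for $\tau\ge1$ and $0\le s_\delta'\le1+\delta$, and put $K_{\rho,t,\delta}(x)=\bigl(s_\delta((t-\rho(x))/\delta),x\bigr)\in\mathbf R\times U$ for $x\in U$. Put $i_\tau(x)=(\tau,x)$ and $I=[0,1]$, and for an $(m-1)$-dimensional varifold $W$ in $U$ put $$(\mathbf v_1(I)\times W)(\alpha)=\int_0^1\int\alpha\bigl((\tau,x),\mathbf R\times T\bigr)\,dW(x,T)\,d\tau .$$ Suppose that $t\in\mathbf R$ is a Lebesgue point of $\langle V,\rho,\cdot\rangle$, that for some $\iota>0$ the restriction $V\llcorner\{(x,S):t-\iota\le\rho(x)\le t\}$ is a rectifiable $m$-dimensional varifold in $U$, and that $$\lim_{\delta\downarrow0}\|V\|(\{x\in U:t-\delta\le\rho(x)<t\})=0 .$$ Set $V_0=V\llcorner\{(x,S):\rho(x)\ge t\}$ and $V_1=V\llcorner\{(x,S):\rho(x)<t\}$.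 Then every $K_{\rho,t,\delta\,\#}V$ with $\delta\in(0,1)$, as well as $i_{0\#}V_0+i_{1\#}V_1+\mathbf v_1(I)\times\langle V,\rho,t\rangle$, is an $m$-dimensional varifold in $\mathbf R\times U$, and, in the sense of weak convergence of varifolds in $\mathbf R\times U$, $$\lim_{\delta\downarrow0}K_{\rho,t,\delta\,\#}V=i_{0\#}V_0+i_{1\#}V_1+\mathbf v_1(I)\times\langle V,\rho,t\rangle .$$ -/

import Mathlib

open MeasureTheory Filter Topology Set Module
open scoped ENNReal NNReal

noncomputable section

/-! ### Grassmannians -/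

/-- The Grassmannian of `m`-dimensional linear subspaces of `E`. -/
@[ext]
structure Grass (E : Type*) [NormedAddCommGroup E] [InnerProductSpace ℝ E] (m : ℕ) where
  space : Submodule ℝ E
  finrank_eq : finrank ℝ space = m

/-- The metric `dist S T = ‖P_S - P_T‖`, where `P_S` is the orthogonal projection onto `S`. -/
instance Grass.instMetricSpace (E : Type*) [NormedAddCommGroup E] [InnerProductSpace ℝ E]
    [FiniteDimensional ℝ E] (m : ℕ) : MetricSpace (Grass E m) :=
  MetricSpace.induced (fun S : Grass E m => S.space.starProjection)
    (fun _ _ h => Grass.ext (Submodule.starProjection_inj.mp h)) inferInstance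

instance Grass.instMeasurableSpace (E : Type*) [NormedAddCommGroup E] [InnerProductSpace ℝ E]
    [FiniteDimensional ℝ E] (m : ℕ) : MeasurableSpace (Grass E m) := borel _

instance Grass.instBorelSpace (E : Type*) [NormedAddCommGroup E] [InnerProductSpace ℝ E]
    [FiniteDimensional ℝ E] (m : ℕ) : BorelSpace (Grass E m) := ⟨rfl⟩

namespace Vari

/-- The subspace `j₁[ℝ] + jₙ[T]` of `ℝ × E`, where `j₁`, `jₙ` are the canonical injections. -/
def cylSpace {E : Type*} [NormedAddCommGroup E] [InnerProductSpace ℝ E]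
    [FiniteDimensional ℝ E] (T : Submodule ℝ E) : Submodule ℝ (WithLp 2 (ℝ × E)) :=
  ((⊤ : Submodule ℝ ℝ).prod T).map (WithLp.linearEquiv 2 ℝ (ℝ × E)).symm.toLinearMap

theorem finrank_cylSpace {E : Type*} [NormedAddCommGroup E] [InnerProductSpace ℝ E]
    [FiniteDimensional ℝ E] (T : Submodule ℝ E) : finrank ℝ (cylSpace T) = finrank ℝ T + 1 := by
  have h1 : finrank ℝ (cylSpace T) = finrank ℝ ((⊤ : Submodule ℝ ℝ).prod T) :=
    LinearEquiv.finrank_map_eq (WithLp.linearEquiv 2 ℝ (ℝ × E)).symm _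
  let e : ((⊤ : Submodule ℝ ℝ).prod T) ≃ₗ[ℝ] (ℝ × T) :=
    { toFun := fun x => (x.1.1, ⟨x.1.2, x.2.2⟩)
      invFun := fun y => ⟨(y.1, y.2.1), trivial, y.2.2⟩
      map_add' := fun _ _ => rfl
      map_smul' := fun _ _ => rfl
      left_inv := fun _ => rfl
      right_inv := fun _ => rfl }
  rw [h1, e.finrank_eq, Module.finrank_prod, Module.finrank_self, add_comm]

variable {E : Type*} [NormedAddCommGroup E] [InnerProductSpace ℝ E] [FiniteDimensional ℝ E]
  [MeasurableSpace E] [BorelSpace E]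
  {F : Type*} [NormedAddCommGroup F] [InnerProductSpace ℝ F] [FiniteDimensional ℝ F]
  [MeasurableSpace F] [BorelSpace F]
  {m : ℕ}

/-! ### Varifolds and their weak convergence -/

/-- `V` is an `m`-dimensional varifold in the open set `U`, i.e. a Radon measure on
`U × G(E, m)`. Such a measure is represented by its extension by zero to `E × G(E, m)`;
since `G(E, m)` is compact, local finiteness is finiteness on the sets `K × G(E, m)`,
`K ⊆ U` compact. -/
structure IsVarifold (U : Set E) (V : Measure (E × Grass E m)) : Prop where
  carried : V (Uᶜ ×ˢ univ) = 0
  finite_on_compacts : ∀ K ⊆ U, IsCompact K → V (K ×ˢ univ) < ⊤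

/-- Continuous real functions with compact support in `U × G(E, m)`, extended by zero. -/
structure IsTest (U : Set E) (β : E × Grass E m → ℝ) : Prop where
  cont : Continuous β
  compact : HasCompactSupport β
  supp : tsupport β ⊆ U ×ˢ univ

/-- Convergence in the space of `m`-dimensional varifolds in `U`. -/
def VarTendsto {κ : Type*} (U : Set E) (V : κ → Measure (E × Grass E m)) (l : Filter κ)
    (W : Measure (E × Grass E m)) : Prop :=
  ∀ α : E × Grass E m → ℝ, IsTest U α →
    Tendsto (fun i => ∫ p, α p ∂(V i)) l (𝓝 (∫ p, α p ∂W))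

/-! ### Push-forward -/

/-- The Jacobian `‖⋀ₘ (L ∘ P_S)‖` of `L` along the `m`-dimensional subspace `S`,
as the square root of the Gram determinant of `L|_S`. -/
def jac (L : E →L[ℝ] F) (S : Submodule ℝ E) : ℝ :=
  Real.sqrt (LinearMap.det
    ((LinearMap.adjoint (L.toLinearMap.domRestrict S)) ∘ₗ (L.toLinearMap.domRestrict S)))

open Classical in
/-- The push-forward of `V` under `f`, a map of class `C¹` near the points that carry `V`:
`(f_# V)(A) = ∫ 1_A(f x, Df(x)[S]) ‖⋀ₘ (Df(x) ∘ P_S)‖ dV(x, S)`, where the integration is over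
all `(x, S)` with positive Jacobian, i.e. with `dim Df(x)[S] = m`. -/
def push (f : E → F) (V : Measure (E × Grass E m)) : Measure (F × Grass F m) :=
  V.bind fun p =>
    if h : finrank ℝ (p.2.space.map (fderiv ℝ f p.1).toLinearMap) = m then
      ENNReal.ofReal (jac (fderiv ℝ f p.1) p.2.space) •
        Measure.dirac ((f p.1, ⟨p.2.space.map (fderiv ℝ f p.1).toLinearMap, h⟩) : F × Grass F m)
    else 0

/-! ### Rectifiable varifolds -/

/-- `S` is countably `(ℋᵐ, m)` rectifiable: `ℋᵐ` almost all of `S` is contained in a countable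
union of Lipschitz images of `ℝᵐ`. -/
def CountablyRectifiable (m : ℕ) (S : Set E) : Prop :=
  ∃ f : ℕ → EuclideanSpace ℝ (Fin m) → E,
    (∀ i, ∃ K : ℝ≥0, LipschitzWith K (f i)) ∧ μH[(m : ℝ)] (S \ ⋃ i, range (f i)) = 0

/-- The tangent cone of `S` at `a`. -/
def tanCone (S : Set E) (a : E) : Set E :=
  {v | ∀ ε > 0, ∃ x ∈ S, ∃ r > 0, ‖x - a‖ < ε ∧ ‖r • (x - a) - v‖ < ε}

/-- The cone `Tanᵐ(ℋᵐ ⌞ S, a)` of approximate tangent vectors: the intersection of the tangent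
cones at `a` of all sets whose complement has zero `m`-dimensional `ℋᵐ ⌞ S` density at `a`. -/
def apTan (m : ℕ) (S : Set E) (a : E) : Set E :=
  {v | ∀ R : Set E,
    Tendsto (fun r : ℝ => μH[(m : ℝ)] ((S ∩ Metric.closedBall a r) \ R) / ENNReal.ofReal (r ^ m))
      (𝓝[>] 0) (𝓝 0) → v ∈ tanCone R a}

/-- `V` is a rectifiable `m`-dimensional varifold in `U`: `V = ∑ cᵢ v(Sᵢ)` with `cᵢ > 0` and
`Sᵢ ⊆ U` countably `(ℋᵐ, m)` rectifiable, `ℋᵐ` measurable and of locally finite `ℋᵐ` measure,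
where `v(S)(A) = ℋᵐ {x ∈ S | (x, Tanᵐ(ℋᵐ ⌞ S, x)) ∈ A}`. As the `cᵢ` are arbitrary, the
normalisation of the Hausdorff measure is irrelevant. -/
def IsRectifiableVarifold (U : Set E) (V : Measure (E × Grass E m)) : Prop :=
  IsVarifold U V ∧ ∃ (c : ℕ → ℝ≥0) (S : ℕ → Set E),
    (∀ i, 0 < c i) ∧
    (∀ i, S i ⊆ U ∧ NullMeasurableSet (S i) μH[(m : ℝ)] ∧ CountablyRectifiable m (S i) ∧
      ∀ K ⊆ U, IsCompact K → μH[(m : ℝ)] (S i ∩ K) < ∞) ∧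
    ∀ A : Set (E × Grass E m), MeasurableSet A →
      V A = ∑' i, (c i : ℝ≥0∞) *
        μH[(m : ℝ)] {x ∈ S i | ∃ T : Grass E m, (T.space : Set E) = apTan m (S i) x ∧ (x, T) ∈ A}

/-! ### Slicing by a real-valued function -/

/-- The part of the base space `U` on which `ρ` takes values in `B`, times the Grassmannian. -/
def strip (U : Set E) (ρ : E → ℝ) (B : Set ℝ) : Set (E × Grass E m) :=
  {p | p.1 ∈ U ∧ ρ p.1 ∈ B}

open Classical in
/-- The varifold `(V, ρ)`: `(V, ρ)(β) = ∫ β(x, S ∩ ker Dρ(x)) ‖Dρ(x) ∘ P_S‖ dV(x, S)`, where the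
integration is over all `(x, S)` with `‖Dρ(x) ∘ P_S‖ > 0`, i.e. with
`dim (S ∩ ker Dρ(x)) = dim S - 1`. -/
def sliceMeasure (V : Measure (E × Grass E (m + 1))) (ρ : E → ℝ) : Measure (E × Grass E m) :=
  V.bind fun p =>
    if h : finrank ℝ (p.2.space ⊓ LinearMap.ker (fderiv ℝ ρ p.1).toLinearMap : Submodule ℝ E) = m then
      ENNReal.ofReal ‖(fderiv ℝ ρ p.1).comp p.2.space.starProjection‖ •
        Measure.dirac
          ((p.1, ⟨p.2.space ⊓ LinearMap.ker (fderiv ℝ ρ p.1).toLinearMap, h⟩) : E × Grass E m)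
    else 0

/-- `W` is the slice of `V` with respect to `ρ` at `t`: a varifold with
`W(β) = lim_{r ↓ 0} μ_β(B(t, r)) / ℒ¹(B(t, r))`, where `μ_β` is the image under `ρ` of the measure
`β (V, ρ)`. -/
def IsSlice (U : Set E) (V : Measure (E × Grass E (m + 1))) (ρ : E → ℝ) (t : ℝ)
    (W : Measure (E × Grass E m)) : Prop :=
  IsVarifold U W ∧ ∀ β : E × Grass E m → ℝ, IsTest U β →
    Tendsto (fun r : ℝ => (∫ p in strip U ρ (Metric.closedBall t r), β p ∂(sliceMeasure V ρ)) /
        volume.real (Metric.closedBall t r))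
      (𝓝[>] 0) (𝓝 (∫ p, β p ∂W))

open Classical in
/-- The slice `⟨V, ρ, t⟩`, with value `0` if there is none. -/
def slice (U : Set E) (V : Measure (E × Grass E (m + 1))) (ρ : E → ℝ) (t : ℝ) :
    Measure (E × Grass E m) :=
  if h : ∃ W, IsSlice U V ρ t W then h.choose else 0

/-- The distance `sup {W₁(β) - W₂(β)}` over all test functions `β` with `|β| ≤ 1` and
`Lip β ≤ 1`. -/
def flatDist (U : Set E) (W₁ W₂ : Measure (E × Grass E m)) : ℝ≥0∞ :=
  ⨆ (β : E × Grass E m → ℝ) (_ : IsTest U β ∧ (∀ p, |β p| ≤ 1) ∧ LipschitzWith 1 β),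
    ENNReal.ofReal (∫ p, β p ∂W₁ - ∫ p, β p ∂W₂)

/-- `t` is a Lebesgue point of the slicing operator `⟨V, ρ, ·⟩`. -/
def IsLebesguePoint (U : Set E) (V : Measure (E × Grass E (m + 1))) (ρ : E → ℝ) (t : ℝ) : Prop :=
  (∃ W, IsSlice U V ρ t W) ∧
  Tendsto (fun r : ℝ =>
      (∫⁻ s in Metric.closedBall t r, flatDist U (slice U V ρ s) (slice U V ρ t)) /
        ENNReal.ofReal r)
    (𝓝[>] 0) (𝓝 0)

/-! ### Products with the unit interval and the blow-up maps -/

/-- `j₁[ℝ] + jₙ[T]` as an element of the Grassmannian of `ℝ × E`. -/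
def cyl (T : Grass E m) : Grass (WithLp 2 (ℝ × E)) (m + 1) :=
  ⟨cylSpace T.space, by rw [finrank_cylSpace, T.finrank_eq]⟩

/-- The product `v₁([0, 1]) × W`:
`(v₁([0, 1]) × W)(α) = ∫_{[0, 1]} ∫ α((τ, x), j₁[ℝ] + jₙ[T]) dW(x, T) dτ`. -/
def intervalProd (W : Measure (E × Grass E m)) :
    Measure (WithLp 2 (ℝ × E) × Grass (WithLp 2 (ℝ × E)) (m + 1)) :=
  ((volume.restrict (Icc (0 : ℝ) 1)).prod W).map
    fun q => (WithLp.toLp 2 (q.1, q.2.1), cyl q.2.2)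

/-- The open set `ℝ × U`. -/
def realProd (U : Set E) : Set (WithLp 2 (ℝ × E)) := {p | p.snd ∈ U}

/-- The embedding `i_τ(x) = (τ, x)`. -/
def emb (τ : ℝ) (x : E) : WithLp 2 (ℝ × E) := WithLp.toLp 2 (τ, x)

/-- The admissible smooth truncations `s_δ`. -/
structure IsRamp (δ : ℝ) (s : ℝ → ℝ) : Prop where
  smooth : ContDiff ℝ (⊤ : ℕ∞) s
  eq_self : ∀ τ, δ ≤ τ → τ ≤ 1 - δ → s τ = τ
  eq_zero : ∀ τ ≤ 0, s τ = 0
  eq_one : ∀ τ ≥ 1, s τ = 1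
  deriv_mem : ∀ τ, 0 ≤ deriv s τ ∧ deriv s τ ≤ 1 + δ

/-- The map `K_{ρ,t,δ}(x) = (s((t - ρ(x)) / δ), x)` with `s = s_δ`. -/
def blowMap (ρ : E → ℝ) (t δ : ℝ) (s : ℝ → ℝ) (x : E) : WithLp 2 (ℝ × E) :=
  WithLp.toLp 2 (s ((t - ρ x) / δ), x)

end Vari

end

noncomputable section
namespace Vari

set_option linter.unusedSectionVars false

section
section LinearAlgebra

variable {E : Type*} [NormedAddCommGroup E] [InnerProductSpace ℝ E] [FiniteDimensional ℝ E]
  {m : ℕ}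

/-! ### Orthogonal projections -/

/-! The blow-up map is the graph map of h = s_δ((t - ρ)/δ). Where ρ ≥ t or ρ ≤ t - δ, h is constant
to first order with value 0 or 1, so there V is pushed exactly as by i_0 or i_1. The strip t - δ < ρ
< t has vanishing V-mass, so these parts converge to i_0#V_0 + i_1#V_1. The real question is the
strip itself, where Dh = -(s_δ'/δ) Dρ is so steep that mass survives in the limit.

On a plane S put l = ‖Dh ∘ P_S‖ and J = √(1 + l²), the Jacobian of the graph map. If l > 0, the
graph plane over S and the vertical plane ℝ × (S ∩ ker Dρ) share S ∩ ker Dρ and differ only in one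
direction; J times their distance is at most 3, while J - l ≤ 1. So, for α with bound and Lipschitz
constant C, replacing J α(graph plane) by l α(vertical plane) costs at most 4C per unit of V-mass,
whatever δ is (`abs_jac_mul_sub_le`). On the strip this error vanishes in the limit, and what
remains is the integral of (s_δ'/δ) α over the measure (V, ρ).

That measure is disintegrated over the values of ρ. Its conditional measures, weighted by the
density of the absolutely continuous part of the marginal, are slices at almost every level; at a
Lebesgue point t the singular part of the marginal has density 0. Hence over (t - δ, t) the measure
(V, ρ) agrees with ℒ¹ × ⟨V, ρ, t⟩ up to C · o(δ) on families of test functions with constant C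
(`exists_modulus_of_isLebesguePoint`). The integrands here have constant 2C/δ, which the rate o(δ)
just absorbs. The substitution τ = s_δ((t - u)/δ) then produces the cylinder over [0, 1]
(`integral_ramp_comp`).

This settles Lipschitz α. A general test function is approximated uniformly by Lipschitz ones; the
error is controlled because the Lipschitz case, applied to a cutoff function, bounds the pushed mass
over the strip (`tendsto_setIntegral_blow`). -/

theorem starProjection_sup_span_singleton {H : Submodule ℝ E} {a : E} (ha : a ∈ Hᗮ) :
    (H ⊔ ℝ ∙ a).starProjection = H.starProjection + (ℝ ∙ a).starProjection := by
  ext x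
  refine Submodule.eq_starProjection_of_mem_orthogonal
    (Submodule.add_mem_sup (Submodule.starProjection_apply_mem _ _)
      (Submodule.starProjection_apply_mem _ _)) ?_
  rw [← Submodule.inf_orthogonal, Submodule.mem_inf]
  have h1 : (ℝ ∙ a).starProjection x ∈ Hᗮ :=
    (Submodule.span_singleton_le_iff_mem a Hᗮ).mpr ha (Submodule.starProjection_apply_mem _ _)
  have h2 : H.starProjection x ∈ (ℝ ∙ a)ᗮ := by
    rw [Submodule.mem_orthogonal_singleton_iff_inner_right]
    exact (Submodule.mem_orthogonal' _ _).1 ha _ (Submodule.starProjection_apply_mem _ _)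
  constructor
  · have := Submodule.sub_mem _ (Submodule.sub_starProjection_mem_orthogonal (K := H) x) h1
    simpa [sub_sub] using this
  · have := Submodule.sub_mem _ (Submodule.sub_starProjection_mem_orthogonal (K := ℝ ∙ a) x) h2
    simpa [sub_sub, add_comm] using this

/-- The case `a = 0` is included, since `0⁻¹ = 0` makes both sides vanish. The formula yields
measurability in `a` although the projection may jump at `0`. -/
theorem starProjection_span_singleton_eq (a : E) :
    (ℝ ∙ a).starProjection = (‖a‖ ^ 2)⁻¹ • (innerSL ℝ a).smulRight a := by
  ext x
  rw [Submodule.starProjection_singleton]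
  simp [smul_smul, div_eq_inv_mul]

theorem norm_starProjection_span_sub_le {a b : E} (ha : ‖a‖ = 1) (hb : ‖b‖ = 1) :
    ‖(ℝ ∙ a).starProjection - (ℝ ∙ b).starProjection‖ ≤ 2 * ‖a - b‖ := by
  refine ContinuousLinearMap.opNorm_le_bound _ (by positivity) fun x => ?_
  rw [sub_apply, Submodule.starProjection_unit_singleton ℝ ha,
    Submodule.starProjection_unit_singleton ℝ hb]
  have : inner ℝ a x • a - inner ℝ b x • b
      = inner ℝ a x • (a - b) + inner ℝ (a - b) x • b := by
    rw [inner_sub_left, smul_sub, sub_smul]; abel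
  rw [this]
  refine (norm_add_le _ _).trans ?_
  rw [norm_smul, norm_smul, hb]
  have h1 := norm_inner_le_norm (𝕜 := ℝ) a x
  have h2 := norm_inner_le_norm (𝕜 := ℝ) (a - b) x
  rw [ha] at h1
  nlinarith [norm_nonneg (a - b), mul_le_mul_of_nonneg_right h1 (norm_nonneg (a - b))]

/-! ### Tangential gradients and the splitting of a plane by a linear form -/

/-- The vector representing the linear form `g` on the subspace `S`. -/
def tanGrad (g : E →L[ℝ] ℝ) (S : Submodule ℝ E) : E :=
  (InnerProductSpace.toDual ℝ E).symm (g.comp S.starProjection)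

theorem norm_tanGrad (g : E →L[ℝ] ℝ) (S : Submodule ℝ E) :
    ‖tanGrad g S‖ = ‖g.comp S.starProjection‖ :=
  LinearIsometryEquiv.norm_map _ _

theorem inner_tanGrad (g : E →L[ℝ] ℝ) (S : Submodule ℝ E) (v : E) :
    inner ℝ (tanGrad g S) v = g (S.starProjection v) := by
  simp [tanGrad]

theorem inner_tanGrad_of_mem (g : E →L[ℝ] ℝ) {S : Submodule ℝ E} {v : E} (hv : v ∈ S) :
    inner ℝ (tanGrad g S) v = g v := by
  rw [inner_tanGrad, Submodule.starProjection_eq_self_iff.2 hv]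

theorem tanGrad_mem (g : E →L[ℝ] ℝ) (S : Submodule ℝ E) : tanGrad g S ∈ S := by
  rw [← Submodule.starProjection_eq_self_iff]
  refine ext_inner_right ℝ fun v => ?_
  rw [Submodule.inner_starProjection_left_eq_right, inner_tanGrad, inner_tanGrad,
    Submodule.starProjection_eq_self_iff.2 (Submodule.starProjection_apply_mem S v)]

theorem apply_tanGrad (g : E →L[ℝ] ℝ) (S : Submodule ℝ E) :
    g (tanGrad g S) = ‖tanGrad g S‖ ^ 2 := by
  rw [← inner_tanGrad_of_mem g (tanGrad_mem g S), real_inner_self_eq_norm_sq]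

theorem tanGrad_mem_orthogonal (g : E →L[ℝ] ℝ) (S : Submodule ℝ E) :
    tanGrad g S ∈ (S ⊓ LinearMap.ker g.toLinearMap)ᗮ := by
  rw [Submodule.mem_orthogonal']
  intro v hv
  rw [inner_tanGrad_of_mem g hv.1]
  exact hv.2

/-- With w the tangential gradient, g(w) = ‖w‖², so subtracting (g(v)/‖w‖²) w moves v into the
kernel; if w = 0, then g already vanishes on the plane. -/
theorem inf_ker_sup_span_tanGrad (g : E →L[ℝ] ℝ) (S : Submodule ℝ E) :
    (S ⊓ LinearMap.ker g.toLinearMap) ⊔ ℝ ∙ tanGrad g S = S := by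
  refine le_antisymm (sup_le inf_le_left
    ((Submodule.span_singleton_le_iff_mem _ _).2 (tanGrad_mem g S))) fun v hv => ?_
  set w := tanGrad g S with hw
  by_cases h0 : w = 0
  · refine Submodule.mem_sup_left ⟨hv, ?_⟩
    have := inner_tanGrad_of_mem g hv
    rw [← hw, h0, inner_zero_left] at this
    exact this.symm
  · have h1 : ‖w‖ ^ 2 ≠ 0 := by simpa using h0
    have h2 : v = (v - (g v / ‖w‖ ^ 2) • w) + (g v / ‖w‖ ^ 2) • w := by abel
    rw [h2]
    refine Submodule.add_mem_sup ⟨S.sub_mem hv (S.smul_mem _ (tanGrad_mem g S)), ?_⟩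
      (Submodule.smul_mem _ _ (Submodule.mem_span_singleton_self _))
    change g (v - (g v / ‖w‖ ^ 2) • w) = 0
    rw [map_sub, map_smul, hw, apply_tanGrad, ← hw, smul_eq_mul, div_mul_cancel₀ _ h1, sub_self]

theorem starProjection_inf_ker (g : E →L[ℝ] ℝ) (S : Submodule ℝ E) :
    (S ⊓ LinearMap.ker g.toLinearMap).starProjection
      = S.starProjection - (ℝ ∙ tanGrad g S).starProjection := by
  have h : ((S ⊓ LinearMap.ker g.toLinearMap) ⊔ ℝ ∙ tanGrad g S).starProjection
      = S.starProjection := Submodule.starProjection_inj.2 (inf_ker_sup_span_tanGrad g S)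
  rw [eq_sub_iff_add_eq, ← h, starProjection_sup_span_singleton (tanGrad_mem_orthogonal g S)]

theorem finrank_inf_ker (g : E →L[ℝ] ℝ) (S : Submodule ℝ E) (h : tanGrad g S ≠ 0) :
    finrank ℝ (S ⊓ LinearMap.ker g.toLinearMap : Submodule ℝ E) + 1 = finrank ℝ S := by
  have h1 := Submodule.finrank_sup_add_finrank_inf_eq (S ⊓ LinearMap.ker g.toLinearMap)
    (ℝ ∙ tanGrad g S)
  have h2 : (S ⊓ LinearMap.ker g.toLinearMap) ⊓ ℝ ∙ tanGrad g S = ⊥ := by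
    rw [eq_bot_iff]
    intro v hv
    have h3 := (Submodule.mem_orthogonal _ _).1
      ((Submodule.span_singleton_le_iff_mem _ _).2 (tanGrad_mem_orthogonal g S) hv.2) v hv.1
    simpa using h3
  rw [inf_ker_sup_span_tanGrad, h2, finrank_bot, finrank_span_singleton h] at h1
  omega

theorem inf_ker_eq_of_tanGrad_eq_zero (g : E →L[ℝ] ℝ) (S : Submodule ℝ E)
    (h : tanGrad g S = 0) : S ⊓ LinearMap.ker g.toLinearMap = S := by
  have := inf_ker_sup_span_tanGrad g S
  rwa [h, Submodule.span_zero_singleton, sup_bot_eq] at this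

/-! ### Graphs of linear forms -/

/-- The linear map `v ↦ (g v, v)`. -/
def graphCLM (g : E →L[ℝ] ℝ) : E →L[ℝ] WithLp 2 (ℝ × E) :=
  (WithLp.prodContinuousLinearEquiv 2 ℝ ℝ E).symm.toContinuousLinearMap.comp
    (g.prod (ContinuousLinearMap.id ℝ E))

theorem graphCLM_apply (g : E →L[ℝ] ℝ) (v : E) : graphCLM g v = WithLp.toLp 2 (g v, v) := rfl

theorem graphCLM_injective (g : E →L[ℝ] ℝ) : Function.Injective (graphCLM g) := fun v w h => by
  simpa [graphCLM_apply] using congrArg WithLp.snd h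

theorem finrank_map_graphCLM (g : E →L[ℝ] ℝ) (S : Submodule ℝ E) :
    finrank ℝ (S.map (graphCLM g).toLinearMap) = finrank ℝ S :=
  (Submodule.equivMapOfInjective _ (graphCLM_injective g) S).finrank_eq.symm

theorem inner_graphCLM (g h : E →L[ℝ] ℝ) (v w : E) :
    inner ℝ (graphCLM g v) (graphCLM h w) = g v * h w + inner ℝ v w := by
  simp [graphCLM_apply, WithLp.prod_inner_apply, mul_comm]

/-- The projection of `ℝ × E` onto the second factor. -/
def sndCLM : WithLp 2 (ℝ × E) →L[ℝ] E :=
  (ContinuousLinearMap.snd ℝ ℝ E).comp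
    (WithLp.prodContinuousLinearEquiv 2 ℝ ℝ E).toContinuousLinearMap

theorem sndCLM_apply (x : WithLp 2 (ℝ × E)) : sndCLM x = x.snd := rfl

theorem starProjection_map_graphCLM_zero (T : Submodule ℝ E) :
    (T.map (graphCLM (0 : E →L[ℝ] ℝ)).toLinearMap).starProjection
      = (graphCLM 0).comp (T.starProjection.comp sndCLM) := by
  ext1 x
  refine Submodule.eq_starProjection_of_mem_of_inner_eq_zero
    (Submodule.mem_map_of_mem (Submodule.starProjection_apply_mem _ _)) ?_
  rintro _ ⟨v, hv, rfl⟩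
  change inner ℝ (x - graphCLM 0 (T.starProjection x.snd)) (graphCLM 0 v) = 0
  have : inner ℝ x (graphCLM 0 v) = inner ℝ x.snd v := by
    simp [graphCLM_apply, WithLp.prod_inner_apply]
  rw [inner_sub_left, this, inner_graphCLM, zero_apply, zero_mul, zero_add,
    ← inner_sub_left]
  exact Submodule.starProjection_inner_eq_zero _ _ hv

/-- Over the kernel of g the graph is horizontal, so only the gradient direction of the plane gets
tilted. -/
theorem map_graphCLM_inf_ker (g : E →L[ℝ] ℝ) (S : Submodule ℝ E) :
    (S ⊓ LinearMap.ker g.toLinearMap).map (graphCLM g).toLinearMap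
      = (S ⊓ LinearMap.ker g.toLinearMap).map (graphCLM (0 : E →L[ℝ] ℝ)).toLinearMap := by
  ext x
  simp only [Submodule.mem_map]
  refine exists_congr fun v => and_congr_right fun hv => ?_
  have : g v = 0 := hv.2
  simp [graphCLM_apply, this]

theorem graphCLM_tanGrad_mem_orthogonal (g : E →L[ℝ] ℝ) (S : Submodule ℝ E) :
    graphCLM g (tanGrad g S) ∈
      ((S ⊓ LinearMap.ker g.toLinearMap).map (graphCLM (0 : E →L[ℝ] ℝ)).toLinearMap)ᗮ := by
  rw [Submodule.mem_orthogonal']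
  rintro _ ⟨v, hv, rfl⟩
  change inner ℝ (graphCLM g (tanGrad g S)) (graphCLM 0 v) = 0
  rw [inner_graphCLM, zero_apply, mul_zero, zero_add]
  exact (Submodule.mem_orthogonal' _ _).1 (tanGrad_mem_orthogonal g S) v hv

theorem starProjection_map_graphCLM (g : E →L[ℝ] ℝ) (S : Submodule ℝ E) :
    (S.map (graphCLM g).toLinearMap).starProjection
      = (graphCLM 0).comp ((S.starProjection - (ℝ ∙ tanGrad g S).starProjection).comp sndCLM)
        + (ℝ ∙ graphCLM g (tanGrad g S)).starProjection := by
  have h : S.map (graphCLM g).toLinearMap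
      = (S ⊓ LinearMap.ker g.toLinearMap).map (graphCLM (0 : E →L[ℝ] ℝ)).toLinearMap
        ⊔ ℝ ∙ graphCLM g (tanGrad g S) := by
    conv_lhs => rw [← inf_ker_sup_span_tanGrad g S]
    rw [Submodule.map_sup, map_graphCLM_inf_ker, Submodule.map_span, image_singleton]
    rfl
  rw [Submodule.starProjection_inj.2 h,
    starProjection_sup_span_singleton (graphCLM_tanGrad_mem_orthogonal g S),
    starProjection_map_graphCLM_zero, starProjection_inf_ker]

/-! ### Vertical cylinders compared with tangent planes of graphs -/

/-- The unit vector of the first factor of `ℝ × E`. -/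
def e₀ : WithLp 2 (ℝ × E) := WithLp.toLp 2 (1, 0)

theorem norm_e₀ : ‖(e₀ : WithLp 2 (ℝ × E))‖ = 1 := by
  simp [e₀]

theorem starProjection_cylSpace (T : Submodule ℝ E) :
    (cylSpace T).starProjection
      = (graphCLM 0).comp (T.starProjection.comp sndCLM)
        + (ℝ ∙ (e₀ : WithLp 2 (ℝ × E))).starProjection := by
  have h : cylSpace T = T.map (graphCLM (0 : E →L[ℝ] ℝ)).toLinearMap
      ⊔ ℝ ∙ (e₀ : WithLp 2 (ℝ × E)) := by
    ext x
    simp only [Submodule.mem_sup, cylSpace, Submodule.mem_map, Submodule.mem_span_singleton]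
    constructor
    · rintro ⟨⟨a, v⟩, hv, rfl⟩
      refine ⟨_, ⟨v, hv.2, rfl⟩, _, ⟨a, rfl⟩, ?_⟩
      change graphCLM 0 v + a • e₀ = WithLp.toLp 2 (a, v)
      rw [graphCLM_apply, e₀, ← WithLp.toLp_smul, ← WithLp.toLp_add]
      simp
    · rintro ⟨_, ⟨v, hv, rfl⟩, _, ⟨a, rfl⟩, rfl⟩
      refine ⟨(a, v), ⟨trivial, hv⟩, ?_⟩
      change WithLp.toLp 2 (a, v) = graphCLM 0 v + a • e₀
      rw [graphCLM_apply, e₀, ← WithLp.toLp_smul, ← WithLp.toLp_add]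
      simp
  rw [Submodule.starProjection_inj.2 h, starProjection_sup_span_singleton,
    starProjection_map_graphCLM_zero]
  rw [Submodule.mem_orthogonal']
  rintro _ ⟨v, hv, rfl⟩
  change inner ℝ e₀ (graphCLM 0 v) = 0
  simp [e₀, graphCLM_apply, WithLp.prod_inner_apply]

/-- The Gram operator is the identity plus the rank-one map v ↦ g(v) w, with w the tangential
gradient. This is a transvection, with determinant 1 + g(w) = 1 + ‖w‖². -/
theorem jac_graphCLM (g : E →L[ℝ] ℝ) (S : Submodule ℝ E) :
    jac (graphCLM g) S = Real.sqrt (1 + ‖g.comp S.starProjection‖ ^ 2) := by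
  have h : (LinearMap.adjoint ((graphCLM g).toLinearMap.domRestrict S)) ∘ₗ
      ((graphCLM g).toLinearMap.domRestrict S)
      = LinearMap.transvection (g.toLinearMap.domRestrict S) ⟨tanGrad g S, tanGrad_mem g S⟩ := by
    ext1 v
    refine ext_inner_right ℝ fun u => ?_
    rw [LinearMap.comp_apply, LinearMap.adjoint_inner_left, LinearMap.transvection.apply]
    change inner ℝ (graphCLM g v) (graphCLM g u) = _
    rw [inner_graphCLM, inner_add_left, inner_smul_left]
    change _ = inner ℝ (v : E) u + g v * inner ℝ (tanGrad g S) (u : E)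
    rw [inner_tanGrad_of_mem g u.2, add_comm]
  rw [jac, h, LinearMap.transvection.det, ← norm_tanGrad, ← apply_tanGrad]
  rfl

/-- The tangent planes of steep graphs are nearly vertical. -/
theorem jac_mul_norm_sub_le (g : E →L[ℝ] ℝ) (S : Submodule ℝ E) (h : tanGrad g S ≠ 0) :
    jac (graphCLM g) S * ‖(S.map (graphCLM g).toLinearMap).starProjection
      - (cylSpace (S ⊓ LinearMap.ker g.toLinearMap)).starProjection‖ ≤ 3 := by
  -- The common summand, the projection onto S ∩ ker g, cancels; two lines remain to be compared.
  rw [starProjection_map_graphCLM, starProjection_cylSpace, starProjection_inf_ker,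
    add_sub_add_left_eq_sub, jac_graphCLM, ← norm_tanGrad]
  set w := tanGrad g S with hw
  set l := ‖w‖ with hl
  have hl0 : 0 < l := norm_pos_iff.2 h
  set J := Real.sqrt (1 + l ^ 2) with hJ
  have hJ2 : J ^ 2 = 1 + l ^ 2 := Real.sq_sqrt (by positivity)
  have hJ0 : 0 < J := Real.sqrt_pos.2 (by positivity)
  have hlJ : l ≤ J := by nlinarith
  -- The vector (g w, w) = (l², w) has length √(l⁴ + l²) = l J.
  set a : WithLp 2 (ℝ × E) := (l * J)⁻¹ • graphCLM g w with ha
  have hspan : ℝ ∙ graphCLM g w = ℝ ∙ a := by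
    rw [ha, Submodule.span_singleton_smul_eq (IsUnit.mk0 _ (by positivity))]
  have hgw : ‖graphCLM g w‖ = l * J := by
    rw [← sq_eq_sq₀ (norm_nonneg _) (by positivity), ← real_inner_self_eq_norm_sq,
      inner_graphCLM, hw, apply_tanGrad, ← hw, real_inner_self_eq_norm_sq, mul_pow, hJ2]
    ring
  have hna : ‖a‖ = 1 := by
    rw [ha, norm_smul, hgw, norm_inv, Real.norm_of_nonneg (by positivity)]
    exact inv_mul_cancel₀ (by positivity)
  have hin : inner ℝ a e₀ = l / J := by
    rw [ha, inner_smul_left, graphCLM_apply, hw, apply_tanGrad, ← hw]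
    simp [e₀, WithLp.prod_inner_apply]
    rw [← hl]
    field_simp
  -- The square equals 2(J² - lJ), and l ≤ J gives J² - lJ ≤ J² - l² = 1.
  have hd : (J * ‖a - e₀‖) ^ 2 ≤ 2 := by
    rw [mul_pow, norm_sub_sq_real, hna, norm_e₀, hin]
    have : J ^ 2 * (1 ^ 2 - 2 * (l / J) + 1 ^ 2) = 2 * (J ^ 2 - l * J) := by field_simp; ring
    rw [this]
    nlinarith
  rw [Submodule.starProjection_inj.2 hspan]
  have h1 := mul_le_mul_of_nonneg_left (norm_starProjection_span_sub_le hna norm_e₀) hJ0.le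
  -- Here √2 ≤ 3/2; the factor 2 in the estimate for lines gives the final 3.
  have h2 : J * ‖a - e₀‖ ≤ 3 / 2 := by
    by_contra! hc
    nlinarith [mul_nonneg hJ0.le (norm_nonneg (a - e₀))]
  linarith

end LinearAlgebra
end

section
/-! ### Topology of the Grassmannian -/

section Grassmannian

variable {E : Type*} [NormedAddCommGroup E] [InnerProductSpace ℝ E] [FiniteDimensional ℝ E]
  {m : ℕ}

theorem Grass.dist_eq (S T : Grass E m) :
    dist S T = ‖S.space.starProjection - T.space.starProjection‖ :=
  dist_eq_norm S.space.starProjection T.space.starProjection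

theorem Grass.isometry_starProjection :
    Isometry (fun S : Grass E m => S.space.starProjection) :=
  Isometry.of_dist_eq fun _ _ => rfl

/-- Idempotent and self-adjoint operators are the orthogonal projections, and the trace of a
projection is its rank. All three conditions are closed, which makes the Grassmannian compact. -/
theorem Grass.range_starProjection :
    range (fun S : Grass E m => S.space.starProjection)
      = {p : E →L[ℝ] E | p * p = p ∧ star p = p ∧ LinearMap.trace ℝ E p.toLinearMap = m} := by
  ext p
  constructor
  · rintro ⟨S, rfl⟩
    have h := isStarProjection_starProjection (𝕜 := ℝ) (U := S.space)
    refine ⟨h.1, h.2, ?_⟩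
    have h2 : LinearMap.IsProj S.space S.space.starProjection.toLinearMap :=
      ⟨fun x => Submodule.starProjection_apply_mem _ x,
        fun x hx => Submodule.starProjection_eq_self_iff.2 hx⟩
    rw [h2.trace, S.finrank_eq]
  · rintro ⟨h1, h2, h3⟩
    obtain ⟨K, _, rfl⟩ := isStarProjection_iff_eq_starProjection.1 (⟨h1, h2⟩ : IsStarProjection p)
    refine ⟨⟨K, ?_⟩, rfl⟩
    have h2 : LinearMap.IsProj K K.starProjection.toLinearMap :=
      ⟨fun x => Submodule.starProjection_apply_mem _ x,
        fun x hx => Submodule.starProjection_eq_self_iff.2 hx⟩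
    rw [h2.trace] at h3
    exact_mod_cast h3

theorem Grass.isClosedEmbedding_starProjection :
    IsClosedEmbedding (fun S : Grass E m => S.space.starProjection) := by
  refine ⟨Grass.isometry_starProjection.isEmbedding, ?_⟩
  rw [Grass.range_starProjection]
  refine (isClosed_eq (by fun_prop) continuous_id).inter
    ((isClosed_eq continuous_star continuous_id).inter (isClosed_eq ?_ continuous_const))
  exact LinearMap.continuous_of_finiteDimensional
    ((LinearMap.trace ℝ E).comp (ContinuousLinearMap.coeLM ℝ))

instance Grass.instCompactSpace : CompactSpace (Grass E m) := by
  refine ⟨?_⟩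
  rw [Grass.isClosedEmbedding_starProjection.isCompact_iff, image_univ]
  refine Metric.isCompact_of_isClosed_isBounded
    Grass.isClosedEmbedding_starProjection.isClosed_range ?_
  refine (Metric.isBounded_closedBall (x := (0 : E →L[ℝ] E)) (r := 1)).subset ?_
  rintro _ ⟨S, rfl⟩
  simpa using Submodule.starProjection_norm_le _

/-- A closed embedding is a measurable embedding, so plane-valued maps can be tested on their
projections, for which explicit formulas exist. -/
theorem Grass.measurable_of_starProjection {X : Type*} [MeasurableSpace X] {f : X → Grass E m}
    (hf : Measurable fun x => (f x).space.starProjection) : Measurable f :=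
  Grass.isClosedEmbedding_starProjection.measurableEmbedding.measurable_comp_iff.1 hf

theorem Grass.measurable_starProjection :
    Measurable fun S : Grass E m => S.space.starProjection :=
  Grass.isClosedEmbedding_starProjection.continuous.measurable

theorem Grass.nonempty_of_le (h : m ≤ finrank ℝ E) : Nonempty (Grass E m) := by
  obtain ⟨f, hf⟩ := exists_linearIndependent_of_le_finrank h
  refine ⟨⟨Submodule.span ℝ (range f), ?_⟩⟩
  simpa using finrank_span_eq_card hf

/-- The vertical direction is common to both planes and cancels. With constant 1, integrands on ℝ ×
E restrict to cylinders without loss in their Lipschitz constant. -/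
theorem dist_cyl_le (S T : Grass E m) : dist (cyl S) (cyl T) ≤ dist S T := by
  rw [Grass.dist_eq, Grass.dist_eq]
  change ‖(cylSpace S.space).starProjection - (cylSpace T.space).starProjection‖ ≤ _
  rw [starProjection_cylSpace, starProjection_cylSpace, add_sub_add_right_eq_sub]
  refine ContinuousLinearMap.opNorm_le_bound _ (norm_nonneg _) fun x => ?_
  have : ((graphCLM 0).comp (S.space.starProjection.comp sndCLM)
      - (graphCLM 0).comp (T.space.starProjection.comp sndCLM)) x
      = graphCLM 0 ((S.space.starProjection - T.space.starProjection) x.snd) := by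
    simp [sndCLM_apply]
  rw [this, graphCLM_apply, zero_apply, WithLp.norm_toLp_snd]
  refine (ContinuousLinearMap.le_opNorm _ _).trans ?_
  gcongr
  exact WithLp.norm_snd_le ℝ x

theorem continuous_cyl : Continuous (cyl : Grass E m → _) :=
  (LipschitzWith.of_dist_le_mul (K := 1) fun S T => by simpa using dist_cyl_le S T).continuous

theorem continuous_tanGrad :
    Continuous fun q : (E →L[ℝ] ℝ) × Grass E m => tanGrad q.1 q.2.space := by
  refine (InnerProductSpace.toDual ℝ E).symm.continuous.comp (continuous_fst.clm_comp ?_)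
  exact Grass.isClosedEmbedding_starProjection.continuous.comp continuous_snd

theorem measurable_starProjection_span_singleton [MeasurableSpace E] [BorelSpace E] :
    Measurable fun a : E => (ℝ ∙ a).starProjection := by
  simp_rw [starProjection_span_singleton_eq]
  refine Measurable.smul (f := fun a : E => (‖a‖ ^ 2)⁻¹)
    (g := fun a : E => (innerSL ℝ a).smulRight a) (by fun_prop) (Continuous.measurable ?_)
  exact (ContinuousLinearMap.smulRightL ℝ E E).continuous₂.comp
    ((innerSL ℝ).continuous.prodMk continuous_id)

/-! ### Planes S ∩ ker g and graph planes as measurable functions of (g, S) -/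

open Classical in
/-- The subspace `S ∩ ker g`, with a default value if its dimension is wrong. -/
def kerInter [Nonempty (Grass E m)] (q : (E →L[ℝ] ℝ) × Grass E (m + 1)) : Grass E m :=
  if h : finrank ℝ (q.2.space ⊓ LinearMap.ker q.1.toLinearMap : Submodule ℝ E) = m then
    ⟨_, h⟩
  else Classical.arbitrary _

theorem finrank_inf_ker_eq_iff (g : E →L[ℝ] ℝ) (S : Grass E (m + 1)) :
    finrank ℝ (S.space ⊓ LinearMap.ker g.toLinearMap : Submodule ℝ E) = m
      ↔ tanGrad g S.space ≠ 0 := by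
  constructor
  · intro h h0
    rw [inf_ker_eq_of_tanGrad_eq_zero g _ h0, S.finrank_eq] at h
    omega
  · intro h
    have := finrank_inf_ker g S.space h
    rw [S.finrank_eq] at this
    omega

theorem kerInter_space [Nonempty (Grass E m)] {g : E →L[ℝ] ℝ} {S : Grass E (m + 1)}
    (h : tanGrad g S.space ≠ 0) :
    (kerInter (g, S)).space = S.space ⊓ LinearMap.ker g.toLinearMap := by
  rw [kerInter, dif_pos ((finrank_inf_ker_eq_iff g S).2 h)]

/-- The image of `S` under the graph map `v ↦ (g v, v)`. -/
def graphImg (q : (E →L[ℝ] ℝ) × Grass E m) : Grass (WithLp 2 (ℝ × E)) m :=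
  ⟨q.2.space.map (graphCLM q.1).toLinearMap, by rw [finrank_map_graphCLM, q.2.finrank_eq]⟩

theorem jac_mul_dist_le [Nonempty (Grass E m)] {g : E →L[ℝ] ℝ} {S : Grass E (m + 1)}
    (h : tanGrad g S.space ≠ 0) :
    jac (graphCLM g) S.space * dist (graphImg (g, S)) (cyl (kerInter (g, S))) ≤ 3 := by
  have h1 := jac_mul_norm_sub_le g S.space h
  rw [Grass.dist_eq]
  change _ * ‖(S.space.map (graphCLM g).toLinearMap).starProjection
    - (cylSpace (kerInter (g, S)).space).starProjection‖ ≤ 3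
  rwa [kerInter_space h]

theorem kerInter_smul [Nonempty (Grass E m)] {g : E →L[ℝ] ℝ} (S : Grass E (m + 1)) {c : ℝ}
    (hc : c ≠ 0) : kerInter (c • g, S) = kerInter (g, S) := by
  have : LinearMap.ker (c • g).toLinearMap = LinearMap.ker g.toLinearMap := by
    ext v; simp [hc]
  -- Generalising over the kernels allows the equality to be substituted inside the dependent `if`.
  have h : ∀ K L : Submodule ℝ E, K = L →
      (if h : finrank ℝ (S.space ⊓ K : Submodule ℝ E) = m then (⟨_, h⟩ : Grass E m)
        else Classical.arbitrary _)
      = if h : finrank ℝ (S.space ⊓ L : Submodule ℝ E) = m then ⟨_, h⟩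
        else Classical.arbitrary _ := by
    rintro K _ rfl; rfl
  exact h _ _ this

variable [MeasurableSpace E] [BorelSpace E]

/-- Where the tangential gradient w is nonzero, the projection is P_S - P_w; on the closed set w = 0
it is the constant default value. -/
theorem measurable_kerInter [Nonempty (Grass E m)] :
    Measurable (kerInter : (E →L[ℝ] ℝ) × Grass E (m + 1) → Grass E m) := by
  classical
  have hS : MeasurableSet {q : (E →L[ℝ] ℝ) × Grass E (m + 1) | tanGrad q.1 q.2.space = 0} :=
    (isClosed_eq continuous_tanGrad continuous_const).measurableSet
  refine Grass.measurable_of_starProjection ?_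
  have : (fun q : (E →L[ℝ] ℝ) × Grass E (m + 1) => (kerInter q).space.starProjection)
      = fun q => if tanGrad q.1 q.2.space = 0 then
          (Classical.arbitrary (Grass E m)).space.starProjection
        else q.2.space.starProjection - (ℝ ∙ tanGrad q.1 q.2.space).starProjection := by
    funext q
    split_ifs with h
    · rw [kerInter, dif_neg]
      rw [finrank_inf_ker_eq_iff, not_not]
      exact h
    · rw [← starProjection_inf_ker]
      exact Submodule.starProjection_inj.2 (kerInter_space h)
  rw [this]
  exact Measurable.ite hS measurable_const
    ((Grass.measurable_starProjection.comp measurable_snd).sub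
      (measurable_starProjection_span_singleton.comp continuous_tanGrad.measurable))

theorem measurable_graphImg :
    Measurable (graphImg : (E →L[ℝ] ℝ) × Grass E m → Grass (WithLp 2 (ℝ × E)) m) := by
  refine Grass.measurable_of_starProjection ?_
  have : (fun q : (E →L[ℝ] ℝ) × Grass E m => (graphImg q).space.starProjection)
      = fun q => (graphCLM 0).comp ((q.2.space.starProjection
          - (ℝ ∙ tanGrad q.1 q.2.space).starProjection).comp sndCLM)
        + (ℝ ∙ graphCLM q.1 (tanGrad q.1 q.2.space)).starProjection :=
    funext fun q => starProjection_map_graphCLM q.1 q.2.space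
  rw [this]
  have h1 : Measurable fun q : (E →L[ℝ] ℝ) × Grass E m =>
      q.2.space.starProjection - (ℝ ∙ tanGrad q.1 q.2.space).starProjection :=
    (Grass.measurable_starProjection.comp measurable_snd).sub
      (measurable_starProjection_span_singleton.comp continuous_tanGrad.measurable)
  have h2 : Continuous fun A : E →L[ℝ] E => (graphCLM (0 : E →L[ℝ] ℝ)).comp (A.comp sndCLM) :=
    continuous_const.clm_comp (continuous_id.clm_comp continuous_const)
  have h3 : Continuous fun q : (E →L[ℝ] ℝ) × Grass E m =>
      graphCLM q.1 (tanGrad q.1 q.2.space) := by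
    simp only [graphCLM_apply]
    refine (WithLp.prodContinuousLinearEquiv 2 ℝ ℝ E).symm.continuous.comp
      (Continuous.prodMk (continuous_fst.clm_apply continuous_tanGrad) continuous_tanGrad)
  exact (h2.measurable.comp h1).add
    (measurable_starProjection_span_singleton.comp h3.measurable)

theorem continuous_jac_graphCLM :
    Continuous fun q : (E →L[ℝ] ℝ) × Grass E m => jac (graphCLM q.1) q.2.space := by
  simp only [jac_graphCLM, ← norm_tanGrad]
  exact (continuous_const.add (continuous_tanGrad.norm.pow 2)).sqrt

end Grassmannian
end

section
/-! ### Push-forward and slicing as images of weighted measures -/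

theorem bind_congr_ae {X Y : Type*} [MeasurableSpace X] [MeasurableSpace Y] {μ : Measure X}
    {f g : X → Measure Y} (h : f =ᵐ[μ] g) : μ.bind f = μ.bind g := by
  rw [Measure.bind, Measure.bind, Measure.map_congr h]

/-- Used to rewrite `push` and `sliceMeasure` as images of weighted measures, for which change of
variables is available. -/
theorem bind_smul_dirac {X Y : Type*} [MeasurableSpace X] [MeasurableSpace Y] (μ : Measure X)
    {c : X → ℝ≥0∞} {f : X → Y} (hc : Measurable c) (hf : Measurable f) :
    μ.bind (fun x => c x • Measure.dirac (f x)) = (μ.withDensity c).map f := by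
  have hm : Measurable fun x => c x • Measure.dirac (f x) := by
    refine Measure.measurable_of_measurable_coe _ fun s hs => ?_
    simp only [Measure.smul_apply, smul_eq_mul, Measure.dirac_apply' _ hs]
    exact hc.mul ((measurable_one.indicator hs).comp hf)
  ext s hs
  rw [Measure.bind_apply hs hm.aemeasurable, Measure.map_apply hf hs,
    withDensity_apply _ (hf hs), ← lintegral_indicator (hf hs)]
  refine lintegral_congr fun x => ?_
  by_cases hx : f x ∈ s
  · simp [Measure.dirac_apply' _ hs, hx]
  · simp [Measure.dirac_apply' _ hs, hx]

theorem integrable_of_bounded_of_eq_zero_off {X : Type*} [MeasurableSpace X] {μ : Measure X}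
    {f : X → ℝ} {A : Set X} {C : ℝ} (hf : AEStronglyMeasurable f μ)
    (hμ : μ A < ∞) (hC : ∀ x, |f x| ≤ C) (h0 : ∀ x ∉ A, f x = 0) : Integrable f μ := by
  rw [← integrableOn_iff_integrable_of_support_subset (s := A)
    (fun x hx => by_contra fun h => hx (h0 x h))]
  exact Measure.integrableOn_of_bounded hμ.ne hf (ae_of_all _ hC)

/-! ### Varifolds and test functions -/

variable {E : Type*} [NormedAddCommGroup E] [InnerProductSpace ℝ E] [FiniteDimensional ℝ E]
  [MeasurableSpace E] [BorelSpace E] {m : ℕ} {U : Set E}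

theorem IsVarifold.ae_mem {V : Measure (E × Grass E m)} (hV : IsVarifold U V) :
    ∀ᵐ p ∂V, p.1 ∈ U := by
  rw [ae_iff]
  convert hV.carried using 2
  ext p; simp

theorem IsVarifold.mono {V W : Measure (E × Grass E m)} (hV : IsVarifold U V) (h : W ≤ V) :
    IsVarifold U W :=
  ⟨le_antisymm ((h _).trans hV.carried.le) (zero_le), fun K hK hc =>
    (h _).trans_lt (hV.finite_on_compacts K hK hc)⟩

theorem IsVarifold.add {V W : Measure (E × Grass E m)} (hV : IsVarifold U V)
    (hW : IsVarifold U W) : IsVarifold U (V + W) :=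
  ⟨by simp [hV.carried, hW.carried], fun K hK hc => by
    simpa using ⟨hV.finite_on_compacts K hK hc, hW.finite_on_compacts K hK hc⟩⟩

/-- An open subset of E is σ-compact, and the rest of the space is null. Fubini's theorem for
products with the interval rests on this. -/
theorem IsVarifold.sigmaFinite {V : Measure (E × Grass E m)} (hV : IsVarifold U V)
    (hU : IsOpen U) : SigmaFinite V := by
  have : LocallyCompactSpace U := hU.locallyCompactSpace
  obtain ⟨K, hK, hKU⟩ : IsSigmaCompact U := isSigmaCompact_iff_sigmaCompactSpace.2 inferInstance
  refine Measure.sigmaFinite_of_countable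
    (S := insert (Uᶜ ×ˢ univ) (range fun n => K n ×ˢ univ)) ((countable_range _).insert _) ?_ ?_
  · rintro s (rfl | ⟨n, rfl⟩)
    · rw [hV.carried]; exact ENNReal.zero_lt_top
    · exact hV.finite_on_compacts _ (hKU ▸ subset_iUnion K n) (hK n)
  · refine eq_univ_of_forall fun p => ?_
    by_cases hp : p.1 ∈ U
    · rw [← hKU, mem_iUnion] at hp
      obtain ⟨n, hn⟩ := hp
      exact ⟨_, Or.inr ⟨n, rfl⟩, hn, trivial⟩
    · exact ⟨_, Or.inl rfl, hp, trivial⟩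

theorem IsTest.exists_bound {β : E × Grass E m → ℝ} (hβ : IsTest U β) :
    ∃ C, 0 < C ∧ ∀ p, |β p| ≤ C := by
  obtain ⟨C, hC⟩ := hβ.compact.exists_bound_of_continuous hβ.cont
  exact ⟨max C 1, by positivity, fun p => (hC p).trans (le_max_left _ _)⟩

theorem IsTest.exists_compact {β : E × Grass E m → ℝ} (hβ : IsTest U β) :
    ∃ K ⊆ U, IsCompact K ∧ ∀ p, p.1 ∉ K → β p = 0 := by
  refine ⟨Prod.fst '' tsupport β, ?_, hβ.compact.isCompact.image continuous_fst, fun p hp => ?_⟩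
  · rintro _ ⟨p, hp, rfl⟩
    exact (hβ.supp hp).1
  · by_contra h
    exact hp ⟨p, subset_tsupport _ h, rfl⟩

theorem IsTest.of_compact {β : E × Grass E m → ℝ} {K : Set E} (hc : Continuous β)
    (hK : IsCompact K) (hKU : K ⊆ U) (h0 : ∀ p, p.1 ∉ K → β p = 0) : IsTest U β := by
  have hs : tsupport β ⊆ K ×ˢ univ := by
    refine closure_minimal (fun p hp => ⟨?_, trivial⟩) (hK.isClosed.prod isClosed_univ)
    by_contra h
    exact hp (h0 p h)
  exact ⟨hc, (hK.prod isCompact_univ).of_isClosed_subset (isClosed_tsupport _) hs,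
    hs.trans (prod_mono hKU subset_rfl)⟩

theorem IsVarifold.integrable {V : Measure (E × Grass E m)} (hV : IsVarifold U V)
    {β : E × Grass E m → ℝ} {K : Set E} {C : ℝ} (hβ : AEStronglyMeasurable β V)
    (hK : IsCompact K) (hKU : K ⊆ U) (hC : ∀ p, |β p| ≤ C) (h0 : ∀ p, p.1 ∉ K → β p = 0) :
    Integrable β V :=
  integrable_of_bounded_of_eq_zero_off hβ (hV.finite_on_compacts K hKU hK) hC fun p hp => h0 p fun h => hp ⟨h, trivial⟩

theorem IsVarifold.integrable_test {V : Measure (E × Grass E m)} (hV : IsVarifold U V)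
    {β : E × Grass E m → ℝ} (hβ : IsTest U β) : Integrable β V := by
  obtain ⟨C, -, hC⟩ := hβ.exists_bound
  obtain ⟨K, hKU, hK, h0⟩ := hβ.exists_compact
  exact hV.integrable hβ.cont.aestronglyMeasurable hK hKU hC h0

/-! ### The measure (V, ρ) behind the slices -/

/-- The density of `sliceMeasure`. -/
def sliceDensity (ρ : E → ℝ) (p : E × Grass E m) : ℝ :=
  ‖(fderiv ℝ ρ p.1).comp p.2.space.starProjection‖

theorem measurable_sliceDensity (ρ : E → ℝ) :
    Measurable (sliceDensity ρ : E × Grass E m → ℝ) := by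
  have h : (sliceDensity ρ : E × Grass E m → ℝ)
      = (fun q : (E →L[ℝ] ℝ) × Grass E m => ‖tanGrad q.1 q.2.space‖)
        ∘ fun p => (fderiv ℝ ρ p.1, p.2) := funext fun p => (norm_tanGrad _ _).symm
  rw [h]
  exact continuous_tanGrad.norm.measurable.comp
    (((measurable_fderiv ℝ ρ).comp measurable_fst).prodMk measurable_snd)

/-- The map `(x, S) ↦ (x, S ∩ ker Dρ(x))`. -/
def slicePoint [Nonempty (Grass E m)] (ρ : E → ℝ) (p : E × Grass E (m + 1)) : E × Grass E m :=
  (p.1, kerInter (fderiv ℝ ρ p.1, p.2))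

theorem measurable_slicePoint [Nonempty (Grass E m)] (ρ : E → ℝ) :
    Measurable (slicePoint ρ : E × Grass E (m + 1) → E × Grass E m) :=
  measurable_fst.prodMk (measurable_kerInter.comp
    (((measurable_fderiv ℝ ρ).comp measurable_fst).prodMk measurable_snd))

theorem sliceMeasure_eq [Nonempty (Grass E m)] (V : Measure (E × Grass E (m + 1))) (ρ : E → ℝ) :
    sliceMeasure V ρ
      = (V.withDensity fun p => ENNReal.ofReal (sliceDensity ρ p)).map (slicePoint ρ) := by
  rw [← bind_smul_dirac V (measurable_sliceDensity ρ).ennreal_ofReal (measurable_slicePoint ρ)]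
  unfold sliceMeasure
  congr 1
  funext p
  split_ifs with h
  · have h2 : kerInter (fderiv ℝ ρ p.1, p.2) = ⟨_, h⟩ := dif_pos h
    rw [slicePoint, h2]
    rfl
  -- A wrong dimension means a vanishing tangential gradient, hence zero density: the default value
  -- of `kerInter` carries no mass.
  · rw [finrank_inf_ker_eq_iff, not_not] at h
    rw [sliceDensity, ← norm_tanGrad, h]
    simp

theorem setIntegral_sliceMeasure [Nonempty (Grass E m)] (V : Measure (E × Grass E (m + 1)))
    (ρ : E → ℝ) {B : Set E} (hB : MeasurableSet B) {φ : E × Grass E m → ℝ}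
    (hφ : Measurable φ) :
    ∫ p in B ×ˢ univ, φ p ∂(sliceMeasure V ρ)
      = ∫ p in B ×ˢ univ, sliceDensity ρ p * φ (slicePoint ρ p) ∂V := by
  have hB1 : MeasurableSet (B ×ˢ (univ : Set (Grass E m))) := hB.prod MeasurableSet.univ
  have hB2 : MeasurableSet (B ×ˢ (univ : Set (Grass E (m + 1)))) := hB.prod MeasurableSet.univ
  have hpre : (slicePoint ρ : E × Grass E (m + 1) → E × Grass E m) ⁻¹' (B ×ˢ univ)
      = B ×ˢ univ := by ext p; simp [slicePoint]
  rw [sliceMeasure_eq, setIntegral_map hB1 hφ.aestronglyMeasurable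
    (measurable_slicePoint ρ).aemeasurable, hpre, restrict_withDensity hB2,
    integral_withDensity_eq_integral_toReal_smul (measurable_sliceDensity ρ).ennreal_ofReal
      (ae_of_all _ fun _ => ENNReal.ofReal_lt_top)]
  refine integral_congr_ae (ae_of_all _ fun p => ?_)
  simp [ENNReal.toReal_ofReal (show 0 ≤ sliceDensity ρ p from norm_nonneg _)]

/-! ### Push-forward under graph maps -/

/-- The map `x ↦ (h x, x)`. -/
def graphMap (h : E → ℝ) (x : E) : WithLp 2 (ℝ × E) := WithLp.toLp 2 (h x, x)

theorem fderiv_graphMap {h : E → ℝ} {x : E} (hx : DifferentiableAt ℝ h x) :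
    fderiv ℝ (graphMap h) x = graphCLM (fderiv ℝ h x) :=
  ((WithLp.prodContinuousLinearEquiv 2 ℝ ℝ E).symm.hasFDerivAt.comp x
    (hx.hasFDerivAt.prodMk (hasFDerivAt_id x))).fderiv

/-- The Jacobian of the graph map of `h` along `S` at `x`. -/
def graphJac (h : E → ℝ) (p : E × Grass E m) : ℝ := jac (graphCLM (fderiv ℝ h p.1)) p.2.space

theorem measurable_graphJac (h : E → ℝ) : Measurable (graphJac h : E × Grass E m → ℝ) :=
  (continuous_jac_graphCLM (m := m)).measurable.comp
    (((measurable_fderiv ℝ h).comp measurable_fst).prodMk measurable_snd)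

theorem graphJac_nonneg (h : E → ℝ) (p : E × Grass E m) : 0 ≤ graphJac h p := Real.sqrt_nonneg _

/-- The map induced by the graph map of `h` on points and planes. -/
def graphPoint (h : E → ℝ) (p : E × Grass E m) :
    WithLp 2 (ℝ × E) × Grass (WithLp 2 (ℝ × E)) m :=
  (graphMap h p.1, graphImg (fderiv ℝ h p.1, p.2))

/-- Since h is controlled on U only, its extension by zero supplies a globally measurable
representative; a varifold in U does not see the change. -/
theorem measurable_toLp_indicator (hU : IsOpen U) {h : E → ℝ} (hh : ContinuousOn h U) :
    Measurable fun x => (WithLp.toLp 2 (U.indicator h x, x) : WithLp 2 (ℝ × E)) := by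
  have h1 : Measurable (U.indicator h) := by
    classical
    rw [← piecewise_eq_indicator]
    exact hh.measurable_piecewise continuousOn_const hU.measurableSet
  exact (WithLp.prodContinuousLinearEquiv 2 ℝ ℝ E).symm.continuous.measurable.comp
    (h1.prodMk measurable_id)

theorem measurable_graphPoint_indicator (hU : IsOpen U) {h : E → ℝ} (hh : ContinuousOn h U) :
    Measurable fun p : E × Grass E m =>
      ((WithLp.toLp 2 (U.indicator h p.1, p.1) : WithLp 2 (ℝ × E)),
        graphImg (fderiv ℝ h p.1, p.2)) :=
  ((measurable_toLp_indicator hU hh).comp measurable_fst).prodMk (measurable_graphImg.comp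
    (((measurable_fderiv ℝ h).comp measurable_fst).prodMk measurable_snd))

theorem graphPoint_ae_eq {h : E → ℝ} {V : Measure (E × Grass E m)} (hV : IsVarifold U V) :
    graphPoint h =ᵐ[V] fun p : E × Grass E m =>
      ((WithLp.toLp 2 (U.indicator h p.1, p.1) : WithLp 2 (ℝ × E)),
        graphImg (fderiv ℝ h p.1, p.2)) := by
  filter_upwards [hV.ae_mem] with p hp
  simp [graphPoint, graphMap, hp]

theorem aemeasurable_graphPoint (hU : IsOpen U) {h : E → ℝ} (hh : ContinuousOn h U)
    {V : Measure (E × Grass E m)} (hV : IsVarifold U V) : AEMeasurable (graphPoint h) V :=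
  ⟨_, measurable_graphPoint_indicator hU hh, graphPoint_ae_eq hV⟩

/-- The differential of a graph map is injective, so over U every image plane has full dimension and
the zero branch of `push` never occurs. -/
theorem push_graphMap (hU : IsOpen U) {h : E → ℝ} (hh : ContDiffOn ℝ 1 h U)
    {V : Measure (E × Grass E m)} (hV : IsVarifold U V) :
    push (graphMap h) V
      = (V.withDensity fun p => ENNReal.ofReal (graphJac h p)).map (graphPoint h) := by
  have hae := (withDensity_absolutelyContinuous V
    (fun p => ENNReal.ofReal (graphJac h p))).ae_eq (graphPoint_ae_eq (h := h) hV)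
  rw [Measure.map_congr hae, ← bind_smul_dirac V (measurable_graphJac h).ennreal_ofReal
    (measurable_graphPoint_indicator hU hh.continuousOn)]
  refine bind_congr_ae ?_
  filter_upwards [hV.ae_mem] with p hp
  have hd : fderiv ℝ (graphMap h) p.1 = graphCLM (fderiv ℝ h p.1) :=
    fderiv_graphMap ((hh.differentiableOn one_ne_zero).differentiableAt (hU.mem_nhds hp))
  have hr : finrank ℝ (p.2.space.map (fderiv ℝ (graphMap h) p.1).toLinearMap) = m := by
    rw [hd, finrank_map_graphCLM, p.2.finrank_eq]
  rw [dif_pos hr]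
  have h2 : (⟨_, hr⟩ : Grass (WithLp 2 (ℝ × E)) m) = graphImg (fderiv ℝ h p.1, p.2) := by
    ext1; simp only [hd, graphImg]
  rw [h2, hd, indicator_of_mem hp]
  rfl

theorem integral_push_graphMap (hU : IsOpen U) {h : E → ℝ} (hh : ContDiffOn ℝ 1 h U)
    {V : Measure (E × Grass E m)} (hV : IsVarifold U V)
    {α : WithLp 2 (ℝ × E) × Grass (WithLp 2 (ℝ × E)) m → ℝ} (hα : Measurable α) :
    ∫ q, α q ∂(push (graphMap h) V) = ∫ p, graphJac h p * α (graphPoint h p) ∂V := by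
  rw [push_graphMap hU hh hV, integral_map ((aemeasurable_graphPoint hU hh.continuousOn hV).mono_ac
      (withDensity_absolutelyContinuous _ _)) hα.aestronglyMeasurable,
    integral_withDensity_eq_integral_toReal_smul (measurable_graphJac h).ennreal_ofReal
      (ae_of_all _ fun _ => ENNReal.ofReal_lt_top)]
  simp [ENNReal.toReal_ofReal (graphJac_nonneg h _)]

theorem exists_graphJac_bound (hU : IsOpen U) {h : E → ℝ} (hh : ContDiffOn ℝ 1 h U) {K : Set E}
    (hK : IsCompact K) (hKU : K ⊆ U) :
    ∃ C, 0 < C ∧ ∀ p : E × Grass E m, p.1 ∈ K → graphJac h p ≤ C := by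
  have h1 : ContinuousOn (graphJac h : E × Grass E m → ℝ) (K ×ˢ univ) := by
    refine (continuous_jac_graphCLM (m := m)).comp_continuousOn (ContinuousOn.prodMk ?_
      continuousOn_snd)
    exact ((hh.continuousOn_fderiv_of_isOpen hU le_rfl).mono hKU).comp continuousOn_fst
      fun p hp => hp.1
  obtain ⟨C, hC⟩ := (hK.prod isCompact_univ).exists_bound_of_continuousOn h1
  exact ⟨max C 1, by positivity, fun p hp =>
    ((le_abs_self _).trans (hC p ⟨hp, trivial⟩)).trans (le_max_left _ _)⟩

theorem IsVarifold.push_graphMap (hU : IsOpen U) {h : E → ℝ} (hh : ContDiffOn ℝ 1 h U)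
    {V : Measure (E × Grass E m)} (hV : IsVarifold U V) :
    IsVarifold (realProd U) (push (graphMap h) V) := by
  rw [Vari.push_graphMap hU hh hV]
  have hm : AEMeasurable (graphPoint h) (V.withDensity fun p => ENNReal.ofReal (graphJac h p)) :=
    (aemeasurable_graphPoint hU hh.continuousOn hV).mono_ac
      (withDensity_absolutelyContinuous _ _)
  have hUm : MeasurableSet (realProd U) :=
    (hU.preimage (sndCLM (E := E)).continuous).measurableSet
  constructor
  · rw [Measure.map_apply_of_aemeasurable hm (hUm.compl.prod MeasurableSet.univ)]
    refine withDensity_absolutelyContinuous _ _ ?_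
    refine measure_mono_null (fun p hp => ?_) hV.carried
    exact ⟨hp.1, trivial⟩
  · intro K hK hc
    have hK' : IsCompact (sndCLM '' K) := hc.image sndCLM.continuous
    have hKU : sndCLM '' K ⊆ U := by rintro _ ⟨x, hx, rfl⟩; exact hK hx
    obtain ⟨C, hC0, hC⟩ := exists_graphJac_bound (m := m) hU hh hK' hKU
    rw [Measure.map_apply_of_aemeasurable hm (hc.measurableSet.prod MeasurableSet.univ)]
    -- The second component of the graph map is the identity, so preimages of K lie over its compact
    -- shadow in U.
    have hsub : graphPoint h ⁻¹' (K ×ˢ univ) ⊆ (sndCLM '' K) ×ˢ (univ : Set (Grass E m)) :=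
      fun p hp => ⟨⟨_, hp.1, rfl⟩, trivial⟩
    refine (measure_mono hsub).trans_lt ?_
    rw [withDensity_apply _ (hK'.measurableSet.prod MeasurableSet.univ)]
    calc _ ≤ ∫⁻ _ in (sndCLM '' K) ×ˢ (univ : Set (Grass E m)), ENNReal.ofReal C ∂V :=
          setLIntegral_mono measurable_const fun p hp => ENNReal.ofReal_le_ofReal (hC p hp.1)
      _ < ∞ := by
          rw [setLIntegral_const]
          exact ENNReal.mul_lt_top ENNReal.ofReal_lt_top (hV.finite_on_compacts _ hKU hK')

/-! ### Products with the interval -/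

theorem continuous_toLp_cyl :
    Continuous fun q : ℝ × E × Grass E m =>
      ((WithLp.toLp 2 (q.1, q.2.1) : WithLp 2 (ℝ × E)), cyl q.2.2) :=
  ((WithLp.prodContinuousLinearEquiv 2 ℝ ℝ E).symm.continuous.comp
    (continuous_fst.prodMk (continuous_fst.comp continuous_snd))).prodMk
    (continuous_cyl.comp (continuous_snd.comp continuous_snd))

theorem isVarifold_intervalProd (hU : IsOpen U) {W : Measure (E × Grass E m)}
    (hW : IsVarifold U W) : IsVarifold (realProd U) (intervalProd W) := by
  have := hW.sigmaFinite hU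
  have hUm : MeasurableSet (realProd U) :=
    (hU.preimage (sndCLM (E := E)).continuous).measurableSet
  constructor
  · rw [intervalProd, Measure.map_apply continuous_toLp_cyl.measurable
      (hUm.compl.prod MeasurableSet.univ)]
    refine measure_mono_null (t := univ ×ˢ (Uᶜ ×ˢ univ)) (fun p hp => ⟨trivial, hp.1, trivial⟩) ?_
    rw [Measure.prod_prod, hW.carried, mul_zero]
  · intro K hK hc
    have hK' : IsCompact (sndCLM '' K) := hc.image sndCLM.continuous
    have hKU : sndCLM '' K ⊆ U := by rintro _ ⟨x, hx, rfl⟩; exact hK hx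
    rw [intervalProd, Measure.map_apply continuous_toLp_cyl.measurable
      (hc.measurableSet.prod MeasurableSet.univ)]
    refine (measure_mono (t := univ ×ˢ ((sndCLM '' K) ×ˢ univ))
      fun p hp => ⟨trivial, ⟨_, hp.1, rfl⟩, trivial⟩).trans_lt ?_
    rw [Measure.prod_prod]
    exact ENNReal.mul_lt_top (by simp) (hW.finite_on_compacts _ hKU hK')

theorem integral_intervalProd (hU : IsOpen U) {W : Measure (E × Grass E m)}
    (hW : IsVarifold U W)
    {α : WithLp 2 (ℝ × E) × Grass (WithLp 2 (ℝ × E)) (m + 1) → ℝ} (hα : IsTest (realProd U) α) :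
    ∫ q, α q ∂(intervalProd W)
      = ∫ τ in Icc (0 : ℝ) 1, ∫ p, α (WithLp.toLp 2 (τ, p.1), cyl p.2) ∂W := by
  have := hW.sigmaFinite hU
  have hi := (isVarifold_intervalProd hU hW).integrable_test hα
  rw [intervalProd, integrable_map_measure hα.cont.aestronglyMeasurable
    continuous_toLp_cyl.measurable.aemeasurable] at hi
  rw [intervalProd, integral_map continuous_toLp_cyl.measurable.aemeasurable
    hα.cont.aestronglyMeasurable]
  exact integral_prod _ hi
end

section
/-! ### Weak convergence from a countable family of sets -/

section WeakConvergence

variable {Z : Type*} [MetricSpace Z] [SecondCountableTopology Z] [MeasurableSpace Z]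
  [BorelSpace Z] [Nonempty Z]

theorem integral_comp_nearestPtInd (μ : Measure Z) [IsFiniteMeasure μ] (g : ℕ → ℝ) (N : ℕ) :
    ∫ p, g (SimpleFunc.nearestPtInd (TopologicalSpace.denseSeq Z) N p) ∂μ
      = ∑ k ∈ Finset.range (N + 1),
        μ.real (SimpleFunc.nearestPtInd (TopologicalSpace.denseSeq Z) N ⁻¹' {k}) * g k := by
  set f := SimpleFunc.nearestPtInd (TopologicalSpace.denseSeq Z) N
  have h : (fun p => g (f p))
      = fun p => ∑ k ∈ Finset.range (N + 1), (f ⁻¹' {k}).indicator (fun _ => g k) p := by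
    funext p
    rw [Finset.sum_eq_single (f p)]
    · simp
    · intro k _ hk
      exact indicator_of_notMem (fun h => hk h.symm) _
    · intro hp
      exact absurd (Finset.mem_range.2 (Nat.lt_succ_of_le (SimpleFunc.nearestPtInd_le _ N p))) hp
  rw [h, integral_finsetSum _ fun k _ =>
    (integrable_const _).indicator (f.measurableSet_preimage _)]
  refine Finset.sum_congr rfl fun k _ => ?_
  rw [integral_indicator_const _ (f.measurableSet_preimage _), smul_eq_mul]

/-- The set where the `N`-th nearest point approximation is off by at least `1 / (j + 1)`. -/
def farSet (Z : Type*) [MetricSpace Z] [SecondCountableTopology Z] [MeasurableSpace Z]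
    [BorelSpace Z] [Nonempty Z] (N j : ℕ) : Set Z :=
  {p | ENNReal.ofReal (1 / (j + 1 : ℝ))
    ≤ edist (SimpleFunc.nearestPt (TopologicalSpace.denseSeq Z) N p) p}

theorem measurableSet_farSet (N j : ℕ) : MeasurableSet (farSet Z N j) :=
  measurableSet_le measurable_const ((SimpleFunc.measurable _).edist measurable_id)

theorem tendsto_measure_farSet (μ : Measure Z) [IsFiniteMeasure μ] (j : ℕ) :
    Tendsto (fun N => μ (farSet Z N j)) atTop (𝓝 0) := by
  refine tendstoInMeasure_of_tendsto_ae (μ := μ)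
    (f := fun N => (SimpleFunc.nearestPt (TopologicalSpace.denseSeq Z) N : Z → Z)) (g := id)
    (fun N => (SimpleFunc.stronglyMeasurable _).aestronglyMeasurable)
    (ae_of_all _ fun p => ?_) _ (ENNReal.ofReal_pos.2 (by positivity))
  exact SimpleFunc.tendsto_nearestPt
    (by rw [(TopologicalSpace.denseRange_denseSeq Z).closure_range]; trivial)

/-- Off the far set the modulus of continuity gives ε; on it only the trivial bound 2C is available.
-/
theorem abs_integral_sub_nearestPt_le (μ : Measure Z) [IsFiniteMeasure μ] {β : Z → ℝ}
    (hβ : Continuous β) {C ε : ℝ} (hC : ∀ p, |β p| ≤ C) (hε : 0 ≤ ε) {j : ℕ}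
    (hj : ∀ p q, dist p q < 1 / (j + 1 : ℝ) → |β p - β q| ≤ ε) (N : ℕ) :
    |∫ p, β p ∂μ
        - ∫ p, β (TopologicalSpace.denseSeq Z
          (SimpleFunc.nearestPtInd (TopologicalSpace.denseSeq Z) N p)) ∂μ|
      ≤ ε * μ.real univ + 2 * C * μ.real (farSet Z N j) := by
  have hi1 : Integrable β μ :=
    Integrable.of_bound hβ.aestronglyMeasurable C (ae_of_all _ hC)
  have hi2 : Integrable (fun p => β (TopologicalSpace.denseSeq Z
      (SimpleFunc.nearestPtInd (TopologicalSpace.denseSeq Z) N p))) μ := by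
    refine Integrable.of_bound ?_ C (ae_of_all _ fun p => hC _)
    exact (hβ.measurable.comp
      (SimpleFunc.nearestPt (TopologicalSpace.denseSeq Z) N).measurable).aestronglyMeasurable
  rw [← integral_sub hi1 hi2]
  have hi3 : Integrable (fun p => ε + (farSet Z N j).indicator (fun _ => 2 * C) p) μ :=
    (integrable_const _).add ((integrable_const _).indicator (measurableSet_farSet N j))
  refine (abs_integral_le_integral_abs).trans
    ((integral_mono (hi1.sub hi2).abs hi3 fun p => ?_).trans_eq ?_)
  · simp only [Pi.sub_apply]
    by_cases hp : p ∈ farSet Z N j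
    · rw [indicator_of_mem hp]
      have := abs_sub (β p) (β (TopologicalSpace.denseSeq Z
        (SimpleFunc.nearestPtInd (TopologicalSpace.denseSeq Z) N p)))
      linarith [hC p, hC (TopologicalSpace.denseSeq Z
        (SimpleFunc.nearestPtInd (TopologicalSpace.denseSeq Z) N p))]
    · rw [indicator_of_notMem hp, add_zero]
      refine hj _ _ ?_
      rw [farSet, mem_ofPred_eq, not_le, edist_dist, ENNReal.ofReal_lt_ofReal_iff (by positivity)]
        at hp
      rwa [dist_comm]
  · rw [integral_add (integrable_const _)
        ((integrable_const _).indicator (measurableSet_farSet N j)),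
      integral_indicator_const _ (measurableSet_farSet N j)]
    simp [mul_comm]

/-- There is a countable family of measurable sets on which convergence of finite measures
implies weak convergence. -/
theorem exists_countable_convergence_determining (Z : Type*) [MetricSpace Z]
    [SecondCountableTopology Z] [MeasurableSpace Z] [BorelSpace Z] [Nonempty Z] :
    ∃ 𝒜 : Set (Set Z), 𝒜.Countable ∧ (∀ A ∈ 𝒜, MeasurableSet A) ∧
      ∀ (l : Filter ℝ) (M : ℝ → Measure Z) (W : Measure Z) (_ : ∀ r, IsFiniteMeasure (M r))
        (_ : IsFiniteMeasure W),
        (∀ A ∈ 𝒜, Tendsto (fun r => (M r).real A) l (𝓝 (W.real A))) →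
        ∀ β : Z → ℝ, UniformContinuous β → (∃ C, ∀ p, |β p| ≤ C) →
          Tendsto (fun r => ∫ p, β p ∂(M r)) l (𝓝 (∫ p, β p ∂W)) := by
  -- The cells handle the discretised integrand, while the far sets and `univ` keep the
  -- discretisation error small along the filter.
  refine ⟨insert univ ((range fun q : ℕ × ℕ =>
      SimpleFunc.nearestPtInd (TopologicalSpace.denseSeq Z) q.1 ⁻¹' {q.2})
      ∪ range fun q : ℕ × ℕ => farSet Z q.1 q.2),
    ((countable_range _).union (countable_range _)).insert _, ?_, ?_⟩
  · rintro A (rfl | ⟨q, rfl⟩ | ⟨q, rfl⟩)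
    · exact MeasurableSet.univ
    · exact SimpleFunc.measurableSet_preimage _ _
    · exact measurableSet_farSet _ _
  intro l M W _ _ hM β hβ ⟨C₀, hC₀⟩
  obtain ⟨C, hC1, hC⟩ : ∃ C, 0 < C ∧ ∀ p, |β p| ≤ C :=
    ⟨max C₀ 1, by positivity, fun p => (hC₀ p).trans (le_max_left _ _)⟩
  rw [Metric.tendsto_nhds]
  intro δ hδ
  -- The errors will add up to at most ε(2 W(Z) + 2 + 4C); the remaining 4Cε is slack.
  set ε := δ / (2 * W.real univ + 1 + 8 * C + 1) with hεdef
  have hden : 0 < 2 * W.real univ + 1 + 8 * C + 1 := by positivity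
  have hε : 0 < ε := by positivity
  obtain ⟨η, hη, hηβ⟩ := Metric.uniformContinuous_iff.1 hβ ε hε
  obtain ⟨j, hj⟩ := exists_nat_one_div_lt hη
  have hj' : ∀ p q, dist p q < 1 / (j + 1 : ℝ) → |β p - β q| ≤ ε := fun p q h =>
    (hηβ (h.trans hj)).le
  obtain ⟨N, hN⟩ : ∃ N, W.real (farSet Z N j) < ε := by
    have h := (ENNReal.tendsto_toReal ENNReal.zero_ne_top).comp (tendsto_measure_farSet W j)
    exact ((h.eventually (gt_mem_nhds hε))).exists
  have h1 : ∀ᶠ r in l, (M r).real univ < W.real univ + 1 :=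
    (hM univ (Or.inl rfl)).eventually (gt_mem_nhds (by linarith))
  have h2 : ∀ᶠ r in l, (M r).real (farSet Z N j) < ε :=
    (hM _ (Or.inr (Or.inr ⟨(N, j), rfl⟩))).eventually (gt_mem_nhds hN)
  have h3 : Tendsto (fun r => ∫ p, β (TopologicalSpace.denseSeq Z
        (SimpleFunc.nearestPtInd (TopologicalSpace.denseSeq Z) N p)) ∂(M r)) l
      (𝓝 (∫ p, β (TopologicalSpace.denseSeq Z
        (SimpleFunc.nearestPtInd (TopologicalSpace.denseSeq Z) N p)) ∂W)) := by
    simp only [integral_comp_nearestPtInd _ fun k => β (TopologicalSpace.denseSeq Z k)]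
    exact tendsto_finsetSum _ fun k _ =>
      (hM _ (Or.inr (Or.inl ⟨(N, k), rfl⟩))).mul_const _
  filter_upwards [h1, h2, Metric.tendsto_nhds.1 h3 ε hε] with r hr1 hr2 hr3
  have h4 := abs_integral_sub_nearestPt_le (M r) hβ.continuous hC hε.le hj' N
  have h5 := abs_integral_sub_nearestPt_le W hβ.continuous hC hε.le hj' N
  rw [Real.dist_eq] at hr3 ⊢
  have h6 : δ = ε * (2 * W.real univ + 1 + 8 * C + 1) := by
    rw [hεdef]; field_simp
  have h7 : ε * (M r).real univ ≤ ε * (W.real univ + 1) :=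
    mul_le_mul_of_nonneg_left hr1.le hε.le
  have h8 : 2 * C * (M r).real (farSet Z N j) ≤ 2 * C * ε :=
    mul_le_mul_of_nonneg_left hr2.le (by positivity)
  have h9 : 2 * C * W.real (farSet Z N j) ≤ 2 * C * ε :=
    mul_le_mul_of_nonneg_left hN.le (by positivity)
  have h10 : 0 < C * ε := by positivity
  rw [abs_le] at h4 h5
  rw [abs_lt] at hr3 ⊢
  constructor <;> nlinarith [h4.1, h4.2, h5.1, h5.2, hr3.1, hr3.2]

end WeakConvergence

/-! ### Differentiation of disintegrations -/

section Disintegration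

variable {Z : Type*} [MeasurableSpace Z] [StandardBorelSpace Z] [Nonempty Z]

/-- For fixed A the measure B ↦ P(B × A) has density s ↦ κ_s(A) with respect to the marginal, so
Besicovitch differentiation applies. The exceptional null set depends on A, hence the countable
determining family. -/
theorem ae_tendsto_measure_closedBall_prod (P : Measure (ℝ × Z)) [IsFiniteMeasure P] {A : Set Z}
    (hA : MeasurableSet A) :
    ∀ᵐ s, Tendsto (fun r => P (Metric.closedBall s r ×ˢ A) / volume (Metric.closedBall s r))
      (𝓝[>] 0) (𝓝 (P.condKernel s A * P.fst.rnDeriv volume s)) := by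
  have hm : Measurable fun s => P.condKernel s A :=
    ProbabilityTheory.Kernel.measurable_coe _ hA
  have hfin : IsFiniteMeasure (P.fst.withDensity fun s => P.condKernel s A) := by
    refine isFiniteMeasure_withDensity ?_
    refine ((lintegral_mono fun s => prob_le_one).trans_lt ?_).ne
    simp
  filter_upwards [Besicovitch.ae_tendsto_rnDeriv
      (P.fst.withDensity fun s => P.condKernel s A) volume,
    Measure.rnDeriv_withDensity_left (μ := P.fst) (ν := volume) hm.aemeasurable
      (ae_of_all _ fun s => measure_ne_top _ _)] with s hs1 hs2
  rw [hs2] at hs1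
  refine hs1.congr fun r => ?_
  rw [withDensity_apply _ measurableSet_closedBall,
    Measure.setLIntegral_condKernel_eq_measure_prod measurableSet_closedBall hA]

end Disintegration
end

section
/-! ### Existence of slices almost everywhere -/

variable {E : Type*} [NormedAddCommGroup E] [InnerProductSpace ℝ E] [FiniteDimensional ℝ E]
  [MeasurableSpace E] [BorelSpace E] {m : ℕ} {U : Set E}

theorem strip_eq (ρ : E → ℝ) (B : Set ℝ) :
    (strip U ρ B : Set (E × Grass E m)) = (U ∩ ρ ⁻¹' B) ×ˢ univ := by
  ext p; simp [strip]

theorem measurable_indicator_of_continuousOn (hU : IsOpen U) {ρ : E → ℝ}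
    (hρ : ContinuousOn ρ U) : Measurable (U.indicator ρ) := by
  classical
  rw [← piecewise_eq_indicator]
  exact hρ.measurable_piecewise continuousOn_const hU.measurableSet

theorem measurableSet_inter_preimage (hU : IsOpen U) {ρ : E → ℝ} (hρ : ContinuousOn ρ U)
    {B : Set ℝ} (hB : MeasurableSet B) : MeasurableSet (U ∩ ρ ⁻¹' B) := by
  have : U ∩ ρ ⁻¹' B = U ∩ (U.indicator ρ) ⁻¹' B := by
    ext x
    refine and_congr_right fun hx => ?_
    simp [hx]
  rw [this]
  exact hU.measurableSet.inter (measurable_indicator_of_continuousOn hU hρ hB)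

theorem measurableSet_strip (hU : IsOpen U) {ρ : E → ℝ} (hρ : ContinuousOn ρ U)
    {B : Set ℝ} (hB : MeasurableSet B) : MeasurableSet (strip U ρ B : Set (E × Grass E m)) := by
  rw [strip_eq]
  exact (measurableSet_inter_preimage hU hρ hB).prod MeasurableSet.univ

theorem isCompact_inter_preimage_Icc {ρ : E → ℝ} (hρ : IsProperMap (U.domRestrict ρ)) (a b : ℝ) :
    IsCompact (U ∩ ρ ⁻¹' Icc a b) := by
  have h := (hρ.isCompact_preimage (isCompact_Icc (a := a) (b := b))).image continuous_subtype_val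
  convert h using 1
  ext x
  simp only [mem_inter_iff, mem_preimage, mem_image, Subtype.exists, domRestrict]
  exact ⟨fun h => ⟨x, h.1, h.2, rfl⟩, by rintro ⟨_, h, h', rfl⟩; exact ⟨h, h'⟩⟩

theorem isVarifold_sliceMeasure [Nonempty (Grass E m)] (hU : IsOpen U) {ρ : E → ℝ}
    (hρ : ContDiffOn ℝ 1 ρ U) {V : Measure (E × Grass E (m + 1))} (hV : IsVarifold U V) :
    IsVarifold U (sliceMeasure V ρ) := by
  rw [sliceMeasure_eq]
  constructor
  · rw [Measure.map_apply (measurable_slicePoint ρ) (hU.measurableSet.compl.prod MeasurableSet.univ)]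
    exact withDensity_absolutelyContinuous _ _ hV.carried
  · intro K hKU hK
    rw [Measure.map_apply (measurable_slicePoint ρ) (hK.measurableSet.prod MeasurableSet.univ)]
    have hpre : (slicePoint ρ : E × Grass E (m + 1) → E × Grass E m) ⁻¹' (K ×ˢ univ)
        = K ×ˢ univ := by ext p; simp [slicePoint]
    obtain ⟨C, hC⟩ := hK.exists_bound_of_continuousOn
      ((hρ.continuousOn_fderiv_of_isOpen hU le_rfl).mono hKU)
    rw [hpre, withDensity_apply _ (hK.measurableSet.prod MeasurableSet.univ)]
    calc _ ≤ ∫⁻ _ in K ×ˢ (univ : Set (Grass E (m + 1))), ENNReal.ofReal C ∂V :=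
          setLIntegral_mono measurable_const fun p hp => ENNReal.ofReal_le_ofReal ?_
      _ < ∞ := by
          rw [setLIntegral_const]
          exact ENNReal.mul_lt_top ENNReal.ofReal_lt_top (hV.finite_on_compacts _ hKU hK)
    refine (ContinuousLinearMap.opNorm_comp_le _ _).trans ?_
    refine (mul_le_of_le_one_right (norm_nonneg _) (Submodule.starProjection_norm_le _)).trans ?_
    exact hC _ hp.1

/-! ### Disintegration of (V, ρ) over the values of ρ -/

/-- The part of `(V, ρ)` over `ρ⁻¹[a, b]`, as a measure on triples `(ρ(x), x, T)`. -/
def levelMeasure (U : Set E) (V : Measure (E × Grass E (m + 1))) (ρ : E → ℝ) (a b : ℝ) :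
    Measure (ℝ × E × Grass E m) :=
  ((sliceMeasure V ρ).restrict (strip U ρ (Icc a b))).map fun p => (U.indicator ρ p.1, p)

section Level

variable [Nonempty (Grass E m)] {ρ : E → ℝ} {V : Measure (E × Grass E (m + 1))} {a b : ℝ}

theorem isFiniteMeasure_levelMeasure (hU : IsOpen U) (hρ : ContDiffOn ℝ 1 ρ U)
    (hp : IsProperMap (U.domRestrict ρ)) (hV : IsVarifold U V) :
    IsFiniteMeasure (levelMeasure (m := m) U V ρ a b) := by
  have : IsFiniteMeasure ((sliceMeasure (m := m) V ρ).restrict (strip U ρ (Icc a b))) := by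
    refine ⟨?_⟩
    rw [Measure.restrict_apply_univ, strip_eq]
    exact (isVarifold_sliceMeasure hU hρ hV).finite_on_compacts _ inter_subset_left
      (isCompact_inter_preimage_Icc hp a b)
  unfold levelMeasure
  infer_instance

theorem measurable_indicator_prodMk (hU : IsOpen U) (hρ : ContDiffOn ℝ 1 ρ U) :
    Measurable fun p : E × Grass E m => (U.indicator ρ p.1, p) :=
  ((measurable_indicator_of_continuousOn hU hρ.continuousOn).comp measurable_fst).prodMk
    measurable_id

theorem restrict_levelMeasure (hU : IsOpen U) (hρ : ContDiffOn ℝ 1 ρ U) {B : Set ℝ}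
    (hB : MeasurableSet B) (hBab : B ⊆ Icc a b) :
    (levelMeasure (m := m) U V ρ a b).restrict (B ×ˢ univ)
      = ((sliceMeasure V ρ).restrict (strip U ρ B)).map fun p => (U.indicator ρ p.1, p) := by
  have hpre : ((fun p : E × Grass E m => (U.indicator ρ p.1, p)) ⁻¹' (B ×ˢ univ))
      ∩ strip U ρ (Icc a b) = strip U ρ B := by
    ext p
    constructor
    · rintro ⟨h1, h2⟩
      refine ⟨h2.1, ?_⟩
      simpa [h2.1] using h1
    · rintro ⟨h1, h2⟩
      exact ⟨by simpa [h1] using h2, h1, hBab h2⟩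
  rw [levelMeasure, Measure.restrict_map (measurable_indicator_prodMk hU hρ)
    (hB.prod MeasurableSet.univ), Measure.restrict_restrict
    (measurable_indicator_prodMk hU hρ (hB.prod MeasurableSet.univ)), hpre]

theorem setIntegral_levelMeasure (hU : IsOpen U) (hρ : ContDiffOn ℝ 1 ρ U) {B : Set ℝ}
    (hB : MeasurableSet B) (hBab : B ⊆ Icc a b) {G : ℝ × E × Grass E m → ℝ}
    (hG : Measurable G) :
    ∫ q in B ×ˢ univ, G q ∂(levelMeasure U V ρ a b)
      = ∫ p in strip U ρ B, G (ρ p.1, p) ∂(sliceMeasure V ρ) := by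
  rw [restrict_levelMeasure hU hρ hB hBab, integral_map
    (measurable_indicator_prodMk hU hρ).aemeasurable hG.aestronglyMeasurable]
  refine setIntegral_congr_fun (measurableSet_strip hU hρ.continuousOn hB) fun p hp => ?_
  simp [hp.1]

/-- The candidate for the slice at `s` obtained by disintegration. -/
def sliceAt (P : Measure (ℝ × E × Grass E m)) [IsFiniteMeasure P] (s : ℝ) :
    Measure (E × Grass E m) :=
  P.fst.rnDeriv volume s • P.condKernel s

/-- A single null set has to serve all test functions. Differentiation on the countable determining
family gives, at almost every level, convergence on all its sets at once, and hence of the integrals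
of all test functions. -/
theorem ae_isSlice_sliceAt [hfin : IsFiniteMeasure (levelMeasure (m := m) U V ρ a b)] (hU : IsOpen U) (hρ : ContDiffOn ℝ 1 ρ U) (hV : IsVarifold U V) :
    ∀ᵐ s, s ∈ Ioo a b → IsSlice U V ρ s (sliceAt (levelMeasure U V ρ a b) s) := by
  set P := levelMeasure (m := m) U V ρ a b with hP
  obtain ⟨𝒜, h𝒜c, h𝒜m, h𝒜⟩ := exists_countable_convergence_determining (E × Grass E m)
  have hUm : MeasurableSet (Uᶜ ×ˢ univ : Set (E × Grass E m)) :=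
    hU.measurableSet.compl.prod MeasurableSet.univ
  have hall : ∀ᵐ s, ∀ A ∈ 𝒜,
      Tendsto (fun r => P (Metric.closedBall s r ×ˢ A) / volume (Metric.closedBall s r))
        (𝓝[>] 0) (𝓝 (P.condKernel s A * P.fst.rnDeriv volume s)) :=
    (ae_ball_iff h𝒜c).2 fun A hA => ae_tendsto_measure_closedBall_prod P (h𝒜m A hA)
  filter_upwards [hall, ae_tendsto_measure_closedBall_prod P hUm,
    Measure.rnDeriv_lt_top P.fst volume] with s hs hsU hslt hsab
  have hPU : P (univ ×ˢ (Uᶜ ×ˢ univ)) = 0 := by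
    rw [hP, levelMeasure, Measure.map_apply (measurable_indicator_prodMk hU hρ)
      (MeasurableSet.univ.prod hUm)]
    refine le_antisymm ((Measure.restrict_apply_le _ _).trans ?_) zero_le
    refine (measure_mono fun p hp => ?_).trans (isVarifold_sliceMeasure hU hρ hV).carried.le
    exact hp.2
  have hWfin : IsFiniteMeasure (sliceAt (levelMeasure U V ρ a b) s) := by
    rw [sliceAt]
    exact Measure.smul_finite _ hslt.ne
  refine ⟨⟨?_, fun K _ _ => measure_lt_top _ _⟩, fun β hβ => ?_⟩
  · have h0 : Tendsto (fun r => P (Metric.closedBall s r ×ˢ (Uᶜ ×ˢ univ))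
        / volume (Metric.closedBall s r)) (𝓝[>] 0) (𝓝 0) := by
      refine tendsto_const_nhds.congr fun r => ?_
      rw [measure_mono_null (prod_mono (subset_univ _) subset_rfl) hPU, ENNReal.zero_div]
    have := tendsto_nhds_unique hsU h0
    rw [sliceAt, Measure.smul_apply, smul_eq_mul, mul_comm]
    exact this
  · set M : ℝ → Measure (E × Grass E m) := fun r =>
      ENNReal.ofReal ((2 * r)⁻¹) • (P.restrict (Metric.closedBall s r ×ˢ univ)).snd with hM
    have hMfin : ∀ r, IsFiniteMeasure (M r) := fun r =>
      Measure.smul_finite _ ENNReal.ofReal_ne_top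
    obtain ⟨C, -, hC⟩ := hβ.exists_bound
    have key := h𝒜 (𝓝[>] 0) M (sliceAt (levelMeasure U V ρ a b) s) hMfin hWfin ?_ β
      (hβ.cont.uniformContinuous_of_tendsto_cocompact (x := 0) hβ.compact.is_zero_at_infty)
      ⟨C, hC⟩
    · refine key.congr' ?_
      have hr1 : ∀ᶠ r : ℝ in 𝓝[>] 0, r < min (s - a) (b - s) :=
        nhdsWithin_le_nhds (gt_mem_nhds (lt_min (by linarith [hsab.1]) (by linarith [hsab.2])))
      filter_upwards [hr1, self_mem_nhdsWithin] with r hr hr0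
      have hr0' : 0 < r := hr0
      have hsub : Metric.closedBall s r ⊆ Icc a b := by
        rw [Real.closedBall_eq_Icc]
        exact Icc_subset_Icc (by linarith [hr.trans_le (min_le_left _ _)])
          (by linarith [hr.trans_le (min_le_right _ _)])
      rw [hM, integral_smul_measure, Measure.snd, integral_map measurable_snd.aemeasurable
        hβ.cont.aestronglyMeasurable, hP, setIntegral_levelMeasure hU hρ measurableSet_closedBall
        hsub (G := fun q => β q.2) (hβ.cont.measurable.comp measurable_snd), Real.volume_real_closedBall hr0'.le,
        ENNReal.toReal_ofReal (by positivity), smul_eq_mul, div_eq_inv_mul]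
    · intro A hA
      have h1 := (ENNReal.tendsto_toReal (ENNReal.mul_ne_top (measure_ne_top _ _)
        hslt.ne)).comp (hs A hA)
      have h2 : (sliceAt (levelMeasure U V ρ a b) s).real A
          = (P.condKernel s A * P.fst.rnDeriv volume s).toReal := by
        rw [measureReal_def, sliceAt, Measure.smul_apply, smul_eq_mul, mul_comm]
      rw [h2]
      refine h1.congr' ?_
      filter_upwards [self_mem_nhdsWithin] with r hr0
      have hr0' : 0 < r := hr0
      rw [Function.comp_apply, measureReal_def, hM, Measure.smul_apply,
        Measure.snd_apply (h𝒜m A hA), Measure.restrict_apply (measurable_snd (h𝒜m A hA)),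
        Real.volume_closedBall, smul_eq_mul, ENNReal.ofReal_inv_of_pos (by positivity),
        ENNReal.div_eq_inv_mul]
      congr 3
      ext q
      simp [and_comm]

theorem isSlice_slice {W : Measure (E × Grass E m)} {s : ℝ} (h : IsSlice U V ρ s W) :
    IsSlice U V ρ s (slice U V ρ s) := by
  have h' : ∃ W, IsSlice U V ρ s W := ⟨W, h⟩
  rw [slice, dif_pos h']
  exact h'.choose_spec

/-- `slice` is an arbitrary choice, but its integrals against test functions are determined as
limits, and only these are needed. -/
theorem ae_integral_slice [IsFiniteMeasure (levelMeasure (m := m) U V ρ a b)] (hU : IsOpen U) (hρ : ContDiffOn ℝ 1 ρ U) (hV : IsVarifold U V) :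
    ∀ᵐ s, s ∈ Ioo a b → ∀ β : E × Grass E m → ℝ, IsTest U β →
      ∫ p, β p ∂(slice U V ρ s)
        = ((levelMeasure U V ρ a b).fst.rnDeriv volume s).toReal
          * ∫ p, β p ∂((levelMeasure U V ρ a b).condKernel s) := by
  filter_upwards [ae_isSlice_sliceAt (m := m) (a := a) (b := b) hU hρ hV] with s hs hsab β hβ
  rw [tendsto_nhds_unique ((isSlice_slice (hs hsab)).2 β hβ) ((hs hsab).2 β hβ), sliceAt,
    integral_smul_measure, smul_eq_mul]

end Level

/-! ### The flat distance -/

/-- The supremum in `flatDist` is one-sided, so both β/C and -β/C are used as competitors. -/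
theorem ofReal_abs_integral_sub_le_flatDist {W₁ W₂ : Measure (E × Grass E m)}
    {β : E × Grass E m → ℝ} (hβ : IsTest U β) {C : ℝ} (hC : 0 < C) (hb : ∀ p, |β p| ≤ C)
    (hl : ∀ p q, |β p - β q| ≤ C * dist p q) :
    ENNReal.ofReal |∫ p, β p ∂W₁ - ∫ p, β p ∂W₂| ≤ ENNReal.ofReal C * flatDist U W₁ W₂ := by
  have main : ∀ c : ℝ, |c| = C⁻¹ →
      ENNReal.ofReal (c * (∫ p, β p ∂W₁ - ∫ p, β p ∂W₂)) ≤ flatDist U W₁ W₂ := by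
    intro c hc
    have ht : IsTest U (fun p => c * β p) := by
      obtain ⟨K, hKU, hK, h0⟩ := hβ.exists_compact
      exact IsTest.of_compact (continuous_const.mul hβ.cont) hK hKU fun p hp => by
        rw [h0 p hp, mul_zero]
    have h1 : ∀ p, |c * β p| ≤ 1 := fun p => by
      rw [abs_mul, hc, inv_mul_le_iff₀ hC, mul_one]
      exact hb p
    have h2 : LipschitzWith 1 (fun p => c * β p) := by
      refine LipschitzWith.of_dist_le_mul fun p q => ?_
      rw [Real.dist_eq, ← mul_sub, abs_mul, hc, inv_mul_le_iff₀ hC]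
      simpa using hl p q
    have h3 := le_iSup₂ (f := fun (β : E × Grass E m → ℝ)
      (_ : IsTest U β ∧ (∀ p, |β p| ≤ 1) ∧ LipschitzWith 1 β) =>
        ENNReal.ofReal (∫ p, β p ∂W₁ - ∫ p, β p ∂W₂)) _ ⟨ht, h1, h2⟩
    rw [mul_sub, ← integral_const_mul, ← integral_const_mul]
    exact h3
  set x := ∫ p, β p ∂W₁ - ∫ p, β p ∂W₂
  have hx : ENNReal.ofReal (C⁻¹ * |x|) ≤ flatDist U W₁ W₂ := by
    rcases abs_choice x with h | h
    · rw [h]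
      exact main C⁻¹ (abs_of_pos (by positivity))
    · have := main (-C⁻¹) (by rw [abs_neg]; exact abs_of_pos (by positivity))
      rwa [h, mul_neg, ← neg_mul]
  calc ENNReal.ofReal |x| = ENNReal.ofReal C * ENNReal.ofReal (C⁻¹ * |x|) := by
        rw [← ENNReal.ofReal_mul hC.le, ← mul_assoc, mul_inv_cancel₀ hC.ne', one_mul]
    _ ≤ _ := by gcongr
end

section
/-! ### Slices near a Lebesgue point -/

variable {E : Type*} [NormedAddCommGroup E] [InnerProductSpace ℝ E] [FiniteDimensional ℝ E]
  [MeasurableSpace E] [BorelSpace E] {m : ℕ} {U : Set E}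

theorem exists_lipschitz_cutoff {K : Set E} (hU : IsOpen U) (hK : IsCompact K) (hKU : K ⊆ U) :
    ∃ (χ : E → ℝ) (C : ℝ) (K' : Set E), 0 < C ∧ (∀ x, 0 ≤ χ x) ∧ (∀ x, χ x ≤ 1) ∧
      (∀ x ∈ K, χ x = 1) ∧ IsCompact K' ∧ K' ⊆ U ∧ (∀ x ∉ K', χ x = 0) ∧
      ∀ x y, |χ x - χ y| ≤ C * dist x y := by
  obtain ⟨η, hη, hηU⟩ := hK.exists_cthickening_subset_open hU hKU
  refine ⟨fun x => thickenedIndicator hη K x, max (η.toNNReal⁻¹ : ℝ≥0) 1, Metric.cthickening η K,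
    by positivity, fun x => NNReal.coe_nonneg _, fun x => ?_, fun x hx => ?_, hK.cthickening, hηU,
    fun x hx => ?_, fun x y => ?_⟩
  · exact_mod_cast thickenedIndicator_le_one hη K x
  · simp [thickenedIndicator_one hη K hx]
  · simp [thickenedIndicator_zero hη K fun h => hx (Metric.thickening_subset_cthickening _ _ h)]
  · have h := (lipschitzWith_thickenedIndicator hη K).dist_le_mul x y
    rw [NNReal.dist_eq] at h
    exact h.trans (mul_le_mul_of_nonneg_right (le_max_left _ _) dist_nonneg)

/-- Parametrised test functions with common bounds for their values, Lipschitz constants and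
supports. -/
structure IsTestFamily (C : ℝ) (K : Set E) (F : ℝ → E × Grass E m → ℝ) : Prop where
  meas : Measurable (Function.uncurry F)
  bound : ∀ s p, |F s p| ≤ C
  lip : ∀ s p q, |F s p - F s q| ≤ C * dist p q
  supp : ∀ s p, p.1 ∉ K → F s p = 0

theorem IsTestFamily.continuous {C : ℝ} {K : Set E} {F : ℝ → E × Grass E m → ℝ}
    (hF : IsTestFamily C K F) (s : ℝ) : Continuous (F s) :=
  (LipschitzWith.of_dist_le_mul (K := C.toNNReal) fun p q => by
    rw [Real.dist_eq]
    exact (hF.lip s p q).trans (mul_le_mul_of_nonneg_right (Real.le_coe_toNNReal C)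
      dist_nonneg)).continuous

theorem IsTestFamily.isTest {C : ℝ} {K : Set E} {F : ℝ → E × Grass E m → ℝ}
    (hF : IsTestFamily C K F) (hK : IsCompact K) (hKU : K ⊆ U) (s : ℝ) : IsTest U (F s) :=
  IsTest.of_compact (hF.continuous s) hK hKU (hF.supp s)

theorem IsTestFamily.abs_integral_le {C : ℝ} {K : Set E} {F : ℝ → E × Grass E m → ℝ}
    (hF : IsTestFamily C K F) (hK : IsCompact K) (hKU : K ⊆ U) {W : Measure (E × Grass E m)}
    (hW : IsVarifold U W) (s : ℝ) : |∫ p, F s p ∂W| ≤ C * W.real (K ×ˢ univ) := by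
  rw [← setIntegral_eq_integral_of_forall_compl_eq_zero (s := K ×ˢ univ)
    fun p hp => hF.supp s p fun h => hp ⟨h, trivial⟩]
  exact norm_setIntegral_le_of_norm_le_const (f := F s) (hW.finite_on_compacts K hKU hK)
    fun p _ => hF.bound s p

theorem IsTestFamily.integrableOn_integral {C : ℝ} {K : Set E} {F : ℝ → E × Grass E m → ℝ}
    (hF : IsTestFamily C K F) (hK : IsCompact K) (hKU : K ⊆ U) (hU : IsOpen U)
    {W : Measure (E × Grass E m)} (hW : IsVarifold U W) {B : Set ℝ} (hB : volume B < ∞) :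
    IntegrableOn (fun s => ∫ p, F s p ∂W) B := by
  have := hW.sigmaFinite hU
  exact Measure.integrableOn_of_bounded hB.ne
    hF.meas.stronglyMeasurable.integral_prod_right.aestronglyMeasurable
    (ae_of_all _ fun s => hF.abs_integral_le hK hKU hW s)

section Level

variable [Nonempty (Grass E m)] {ρ : E → ℝ} {V : Measure (E × Grass E (m + 1))} {a b : ℝ}

/-- The flat distance at level s bounds all competitors at once, so the test function may vary with
s at no cost. -/
theorem ofReal_abs_setIntegral_sub_le_flatDist
    [IsFiniteMeasure (levelMeasure (m := m) U V ρ a b)]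
    (hU : IsOpen U) (hρ : ContDiffOn ℝ 1 ρ U) (hV : IsVarifold U V)
    {W : Measure (E × Grass E m)} (hW : IsVarifold U W) {B : Set ℝ} (hB : MeasurableSet B)
    (hBab : B ⊆ Ioo a b) {C : ℝ} (hC : 0 < C) {K : Set E} (hK : IsCompact K) (hKU : K ⊆ U)
    {F : ℝ → E × Grass E m → ℝ} (hF : IsTestFamily C K F) :
    ENNReal.ofReal |(∫ s in B, ((levelMeasure U V ρ a b).fst.rnDeriv volume s).toReal
          * ∫ p, F s p ∂((levelMeasure U V ρ a b).condKernel s))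
        - ∫ s in B, ∫ p, F s p ∂W|
      ≤ ENNReal.ofReal C * ∫⁻ s in B, flatDist U (slice U V ρ s) W := by
  set P := levelMeasure (m := m) U V ρ a b
  have hBfin : volume B < ∞ := (measure_mono hBab).trans_lt (by simp)
  have h1 : Integrable (fun s => (P.fst.rnDeriv volume s).toReal
      * ∫ p, F s p ∂(P.condKernel s)) (volume.restrict B) := by
    have h : Integrable (fun s => (P.fst.rnDeriv volume s).toReal) :=
      integrable_toReal_of_lintegral_ne_top (Measure.measurable_rnDeriv _ _).aemeasurable
        (Measure.lintegral_rnDeriv_lt_top _ _).ne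
    refine (h.mul_bdd (c := C) ?_ (ae_of_all _ fun s => ?_)).restrict
    · exact (hF.meas.stronglyMeasurable.integral_kernel_prod_right
        (κ := P.condKernel)).aestronglyMeasurable
    · exact (norm_integral_le_of_norm_le_const (ae_of_all _ (hF.bound s))).trans (by simp)
  rw [← integral_sub h1 (hF.integrableOn_integral hK hKU hU hW hBfin), ← Real.enorm_eq_ofReal_abs]
  refine (enorm_integral_le_lintegral_enorm _).trans ?_
  -- The constant being finite, measurability of s ↦ `flatDist` is not required.
  rw [← lintegral_const_mul' _ _ ENNReal.ofReal_ne_top]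
  refine lintegral_mono_ae ?_
  filter_upwards [ae_restrict_mem hB, ae_restrict_of_ae
    (ae_integral_slice (m := m) (a := a) (b := b) hU hρ hV)] with s hsB hs
  rw [← hs (hBab hsB) _ (hF.isTest hK hKU s), Real.enorm_eq_ofReal_abs]
  exact ofReal_abs_integral_sub_le_flatDist (hF.isTest hK hKU s) hC (hF.bound s) (hF.lip s)

/-- Disintegration followed by the Lebesgue decomposition of the marginal; almost every slice comes
from the absolutely continuous summand. -/
theorem setIntegral_sliceMeasure_eq_add [IsFiniteMeasure (levelMeasure (m := m) U V ρ a b)]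
    (hU : IsOpen U) (hρ : ContDiffOn ℝ 1 ρ U) {B : Set ℝ} (hB : MeasurableSet B)
    (hBab : B ⊆ Icc a b) {C : ℝ} {K : Set E}
    {F : ℝ → E × Grass E m → ℝ} (hF : IsTestFamily C K F) :
    ∫ p in strip U ρ B, F (ρ p.1) p ∂(sliceMeasure V ρ)
      = ∫ s in B, ∫ p, F s p ∂((levelMeasure U V ρ a b).condKernel s)
          ∂((levelMeasure U V ρ a b).fst.singularPart volume)
        + ∫ s in B, ((levelMeasure U V ρ a b).fst.rnDeriv volume s).toReal
          * ∫ p, F s p ∂((levelMeasure U V ρ a b).condKernel s) := by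
  have h0 := setIntegral_levelMeasure (V := V) (G := Function.uncurry F) hU hρ hB hBab hF.meas
  simp only [Function.uncurry_apply_pair] at h0
  rw [← h0]
  set P := levelMeasure (m := m) U V ρ a b
  have hm : StronglyMeasurable fun s => ∫ p, F s p ∂(P.condKernel s) :=
    hF.meas.stronglyMeasurable.integral_kernel_prod_right (κ := P.condKernel)
  have hb : ∀ s, ‖∫ p, F s p ∂(P.condKernel s)‖ ≤ C := fun s =>
    (norm_integral_le_of_norm_le_const (ae_of_all _ (hF.bound s))).trans (by simp)
  rw [← Measure.setIntegral_condKernel_univ_right hB (Integrable.of_bound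
    hF.meas.aestronglyMeasurable C (ae_of_all _ fun q => hF.bound q.1 q.2))]
  simp only [Function.uncurry_apply_pair]
  conv_lhs => rw [Measure.haveLebesgueDecomposition_add P.fst volume]
  rw [Measure.restrict_add, integral_add_measure
    (Integrable.of_bound hm.aestronglyMeasurable C (ae_of_all _ hb))
    (Integrable.of_bound hm.aestronglyMeasurable C (ae_of_all _ hb)),
    restrict_withDensity hB, integral_withDensity_eq_integral_toReal_smul
      (Measure.measurable_rnDeriv _ _) (ae_restrict_of_ae (Measure.rnDeriv_lt_top _ _))]
  rfl

theorem ofReal_abs_sliceMeasure_sub_le [IsFiniteMeasure (levelMeasure (m := m) U V ρ a b)]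
    (hU : IsOpen U) (hρ : ContDiffOn ℝ 1 ρ U) (hV : IsVarifold U V)
    {W : Measure (E × Grass E m)} (hW : IsVarifold U W) {B : Set ℝ} (hB : MeasurableSet B)
    (hBab : B ⊆ Ioo a b) {C : ℝ} (hC : 0 < C) {K : Set E} (hK : IsCompact K) (hKU : K ⊆ U)
    {F : ℝ → E × Grass E m → ℝ} (hF : IsTestFamily C K F) :
    ENNReal.ofReal |∫ p in strip U ρ B, F (ρ p.1) p ∂(sliceMeasure V ρ)
        - ∫ s in B, ∫ p, F s p ∂W|
      ≤ ENNReal.ofReal C * ((levelMeasure (m := m) U V ρ a b).fst.singularPart volume B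
        + ∫⁻ s in B, flatDist U (slice U V ρ s) W) := by
  rw [setIntegral_sliceMeasure_eq_add hU hρ hB (hBab.trans Ioo_subset_Icc_self) hF, add_sub_assoc]
  refine (ENNReal.ofReal_le_ofReal (abs_add_le _ _)).trans ?_
  rw [ENNReal.ofReal_add (abs_nonneg _) (abs_nonneg _), mul_add]
  refine add_le_add ?_ (ofReal_abs_setIntegral_sub_le_flatDist hU hρ hV hW hB hBab hC hK hKU hF)
  set P := levelMeasure (m := m) U V ρ a b
  have hb : ∀ s, ‖∫ p, F s p ∂(P.condKernel s)‖ ≤ C := fun s =>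
    (norm_integral_le_of_norm_le_const (ae_of_all _ (hF.bound s))).trans (by simp)
  have h := norm_setIntegral_le_of_norm_le_const (μ := P.fst.singularPart volume) (s := B)
    (measure_lt_top _ _) fun s _ => hb s
  refine (ENNReal.ofReal_le_ofReal h).trans_eq ?_
  rw [ENNReal.ofReal_mul hC.le, ofReal_measureReal]

/-- Let χ = 1 on the compact set ρ⁻¹[a, b], with values in [0, 1], and let I be its integral over
the slice at t. Existence of the slice makes the full marginal of B(t, r) equal to 2rI + o(r), and
the Lebesgue point property makes the absolutely continuous part contribute at least 2rI - o(r).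
Only o(r) is left for the singular part. -/
theorem tendsto_singularPart_closedBall_div {t : ℝ}
    [IsFiniteMeasure (levelMeasure (m := m) U V ρ a b)]
    (hU : IsOpen U) (hρ : ContDiffOn ℝ 1 ρ U) (hp : IsProperMap (U.domRestrict ρ))
    (hV : IsVarifold U V) (hab : t ∈ Ioo a b) (ht : IsLebesguePoint (m := m) U V ρ t) :
    Tendsto (fun r : ℝ => (levelMeasure (m := m) U V ρ a b).fst.singularPart volume
      (Metric.closedBall t r) / ENNReal.ofReal r) (𝓝[>] 0) (𝓝 0) := by
  obtain ⟨⟨W₀, hW₀⟩, hflat⟩ := ht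
  have hsl := isSlice_slice hW₀
  set W := slice U V ρ t
  obtain ⟨χ, C, K, hC, hχ0, hχ1, hχK, hK, hKU, hχs, hχl⟩ := exists_lipschitz_cutoff hU
    (isCompact_inter_preimage_Icc hp a b) inter_subset_left
  have hχF : IsTestFamily (m := m) (max C 1) K fun _ p => χ p.1 := by
    have hχc : Continuous χ := (LipschitzWith.of_dist_le_mul (K := C.toNNReal) fun p q => by
      rw [Real.dist_eq]
      exact (hχl p q).trans (mul_le_mul_of_nonneg_right (Real.le_coe_toNNReal C)
        dist_nonneg)).continuous
    refine ⟨(hχc.comp (continuous_fst.comp continuous_snd)).measurable, fun s p => ?_,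
      fun s p q => ?_, fun s p hp => hχs _ hp⟩
    · rw [abs_of_nonneg (hχ0 _)]
      exact (hχ1 _).trans (le_max_right _ _)
    · exact (hχl _ _).trans (mul_le_mul (le_max_left _ _) (le_max_left _ _) dist_nonneg
        (by positivity))
  have hlim := hsl.2 _ (hχF.isTest hK hKU 0)
  set P := levelMeasure (m := m) U V ρ a b with hP
  set I := ∫ p, χ p.1 ∂W
  have hbound : ∀ᶠ r : ℝ in 𝓝[>] 0, P.fst.singularPart volume (Metric.closedBall t r)
        / ENNReal.ofReal r
      ≤ ENNReal.ofReal (2 * ((∫ p in strip U ρ (Metric.closedBall t r), χ p.1 ∂(sliceMeasure V ρ))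
          / volume.real (Metric.closedBall t r) - I))
        + ENNReal.ofReal (max C 1) * ((∫⁻ s in Metric.closedBall t r,
          flatDist U (slice U V ρ s) W) / ENNReal.ofReal r) := by
    have hr1 : ∀ᶠ r : ℝ in 𝓝[>] 0, r < min (t - a) (b - t) :=
      nhdsWithin_le_nhds (gt_mem_nhds (lt_min (by linarith [hab.1]) (by linarith [hab.2])))
    filter_upwards [hr1, self_mem_nhdsWithin] with r hr hr0
    have hr0' : 0 < r := hr0
    have hsub : Metric.closedBall t r ⊆ Ioo a b := by
      rw [Real.closedBall_eq_Icc]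
      exact Icc_subset_Ioo (by linarith [hr.trans_le (min_le_left _ _)])
        (by linarith [hr.trans_le (min_le_right _ _)])
    have hm := measurableSet_closedBall (x := t) (ε := r)
    have hE1 := ofReal_abs_setIntegral_sub_le_flatDist hU hρ hV hsl.1 hm hsub
      (show 0 < max C 1 by positivity) hK hKU hχF
    have hE2 : ∫ p in strip U ρ (Metric.closedBall t r), χ p.1 ∂(sliceMeasure V ρ)
        = P.fst.real (Metric.closedBall t r) := by
      rw [← setIntegral_levelMeasure (G := fun q => χ q.2.1) (a := a) (b := b) hU hρ hm
        (hsub.trans Ioo_subset_Icc_self) ?_]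
      · have h1 : ∀ᵐ q ∂P.restrict (Metric.closedBall t r ×ˢ univ), χ q.2.1 = 1 := by
          refine ae_restrict_of_ae ?_
          rw [hP, levelMeasure]
          refine (ae_map_iff (measurable_indicator_prodMk hU hρ).aemeasurable ?_).2 ?_
          · exact measurableSet_eq_fun (((hχF.continuous 0).comp continuous_snd).measurable)
              measurable_const
          · filter_upwards [ae_restrict_mem (measurableSet_strip hU hρ.continuousOn
              measurableSet_Icc)] with p hp
            exact hχK _ hp
        rw [integral_congr_ae h1, integral_const, measureReal_restrict_apply MeasurableSet.univ,
          measureReal_def, measureReal_def, Measure.fst_apply hm, smul_eq_mul, mul_one]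
        congr 2
        ext q; simp
      · exact ((hχF.continuous 0).comp continuous_snd).measurable
    have hE3 : P.fst.real (Metric.closedBall t r)
        = (P.fst.singularPart volume).real (Metric.closedBall t r)
          + ∫ s in Metric.closedBall t r, (P.fst.rnDeriv volume s).toReal := by
      conv_lhs => rw [Measure.haveLebesgueDecomposition_add P.fst volume]
      rw [measureReal_add_apply, integral_toReal
        (Measure.measurable_rnDeriv _ _).aemeasurable
        (ae_restrict_of_ae (Measure.rnDeriv_lt_top _ _)), measureReal_def (volume.withDensity _),
        withDensity_apply _ hm]
    have hint : Integrable (fun s => (P.fst.rnDeriv volume s).toReal) :=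
      integrable_toReal_of_lintegral_ne_top (Measure.measurable_rnDeriv _ _).aemeasurable
        (Measure.lintegral_rnDeriv_lt_top _ _).ne
    have hκ : ∀ s, ‖∫ p, χ p.1 ∂(P.condKernel s)‖ ≤ 1 := fun s =>
      (norm_integral_le_of_norm_le_const (C := 1) (ae_of_all _ fun p => by
        rw [Real.norm_eq_abs, abs_of_nonneg (hχ0 _)]; exact hχ1 _)).trans (by simp)
    -- The conditional measures have mass 1 and χ ≤ 1; an inequality in this direction suffices.
    have hE4 : ∫ s in Metric.closedBall t r, (P.fst.rnDeriv volume s).toReal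
          * ∫ p, χ p.1 ∂(P.condKernel s)
        ≤ ∫ s in Metric.closedBall t r, (P.fst.rnDeriv volume s).toReal := by
      refine integral_mono (Integrable.restrict (hint.mul_bdd (c := 1) ?_ (ae_of_all _ hκ)))
        hint.restrict fun s => ?_
      · exact (hχF.meas.stronglyMeasurable.integral_kernel_prod_right
          (κ := P.condKernel)).aestronglyMeasurable
      · exact mul_le_of_le_one_right ENNReal.toReal_nonneg ((le_abs_self _).trans (hκ s))
    rw [integral_const, measureReal_restrict_apply MeasurableSet.univ, univ_inter,
      Real.volume_real_closedBall hr0'.le, smul_eq_mul] at hE1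
    set J := ∫ s in Metric.closedBall t r, (P.fst.rnDeriv volume s).toReal
          * ∫ p, χ p.1 ∂(P.condKernel s)
    rw [hE2, Real.volume_real_closedBall hr0'.le]
    have hE5 : (P.fst.singularPart volume).real (Metric.closedBall t r)
        ≤ r * (2 * (P.fst.real (Metric.closedBall t r) / (2 * r) - I)) + |J - 2 * r * I| := by
      have h1 : r * (2 * (P.fst.real (Metric.closedBall t r) / (2 * r) - I))
          = P.fst.real (Metric.closedBall t r) - 2 * r * I := by field_simp
      rw [h1]
      linarith [neg_abs_le (J - 2 * r * I)]
    refine ENNReal.div_le_of_le_mul ?_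
    rw [add_mul, mul_assoc, ENNReal.div_mul_cancel (by simpa using hr0') ENNReal.ofReal_ne_top,
      ← ofReal_measureReal]
    refine (ENNReal.ofReal_le_ofReal hE5).trans (ENNReal.ofReal_add_le.trans ?_)
    refine add_le_add ?_ hE1
    rw [ENNReal.ofReal_mul hr0'.le, mul_comm]
  refine tendsto_of_tendsto_of_tendsto_of_le_of_le' tendsto_const_nhds ?_
    (Eventually.of_forall fun _ => zero_le) hbound
  have h1 : Tendsto (fun r => ENNReal.ofReal (2 *
      ((∫ p in strip U ρ (Metric.closedBall t r), χ p.1 ∂(sliceMeasure V ρ))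
          / volume.real (Metric.closedBall t r) - I))) (𝓝[>] 0) (𝓝 0) := by
    have := ENNReal.tendsto_ofReal ((hlim.sub_const I).const_mul 2)
    rwa [sub_self, mul_zero, ENNReal.ofReal_zero] at this
  have h2 := ENNReal.Tendsto.const_mul hflat (a := ENNReal.ofReal (max C 1))
    (Or.inr ENNReal.ofReal_ne_top)
  rw [mul_zero] at h2
  simpa using h1.add h2

/-- Near a Lebesgue point `t`, the measure `(V, ρ)` over `(t - δ, t)` is close to the product of
Lebesgue measure with the slice at `t`, uniformly over families of test functions. -/
theorem exists_modulus_of_isLebesguePoint {t : ℝ}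
    (hU : IsOpen U) (hρ : ContDiffOn ℝ 1 ρ U) (hp : IsProperMap (U.domRestrict ρ))
    (hV : IsVarifold U V) (ht : IsLebesguePoint (m := m) U V ρ t) :
    ∃ ω : ℝ → ℝ≥0∞, Tendsto (fun δ => ω δ / ENNReal.ofReal δ) (𝓝[>] 0) (𝓝 0) ∧
      ∀ δ ∈ Ioo (0 : ℝ) 1, ∀ C > 0, ∀ K : Set E, IsCompact K → K ⊆ U →
        ∀ F : ℝ → E × Grass E m → ℝ, IsTestFamily C K F →
          ENNReal.ofReal |∫ p in strip U ρ (Ioo (t - δ) t), F (ρ p.1) p ∂(sliceMeasure V ρ)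
            - ∫ s in Ioo (t - δ) t, ∫ p, F s p ∂(slice U V ρ t)| ≤ ENNReal.ofReal C * ω δ := by
  -- One window of radius 1 serves all δ < 1; over it properness of ρ makes (V, ρ) finite.
  have := isFiniteMeasure_levelMeasure (m := m) (a := t - 1) (b := t + 1) hU hρ hp hV
  have hσ := tendsto_singularPart_closedBall_div (a := t - 1) (b := t + 1) hU hρ hp hV
    ⟨by linarith, by linarith⟩ ht
  refine ⟨fun δ => (levelMeasure (m := m) U V ρ (t - 1) (t + 1)).fst.singularPart volume
      (Metric.closedBall t δ)
    + ∫⁻ s in Metric.closedBall t δ, flatDist U (slice U V ρ s) (slice U V ρ t), ?_, ?_⟩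
  · have := hσ.add ht.2
    simpa only [add_zero, ENNReal.add_div] using this
  · intro δ hδ C hC K hK hKU F hF
    obtain ⟨⟨W₀, hW₀⟩, -⟩ := ht
    refine (ofReal_abs_sliceMeasure_sub_le (a := t - 1) (b := t + 1) hU hρ hV
      (isSlice_slice hW₀).1 measurableSet_Ioo
      (Ioo_subset_Ioo (by linarith [hδ.2]) (by linarith)) hC hK hKU hF).trans ?_
    have hsub : Ioo (t - δ) t ⊆ Metric.closedBall t δ := by
      rw [Real.closedBall_eq_Icc]
      exact Ioo_subset_Icc_self.trans (Icc_subset_Icc le_rfl (by linarith [hδ.1]))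
    dsimp only
    gcongr

end Level
end

section
/-! ### Lipschitz approximation -/

/-- Inf-convolution: g(x) = inf_y (f(y) + C d(x, y)) is C-Lipschitz and at most f. -/
theorem exists_lipschitz_approximation {X : Type*} [PseudoMetricSpace X] {f : X → ℝ} {B : ℝ}
    (hf : UniformContinuous f) (hB : ∀ x, |f x| ≤ B) {ε : ℝ} (hε : 0 < ε) :
    ∃ (g : X → ℝ) (C : ℝ), 0 < C ∧ (∀ x, |f x - g x| ≤ ε) ∧
      ∀ x y, |g x - g y| ≤ C * dist x y := by
  obtain ⟨η, hη, hηf⟩ := Metric.uniformContinuous_iff.1 hf ε hε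
  -- At distance at least η the penalty exceeds the total oscillation 2|B|; the added 1 keeps C
  -- positive.
  set C := 2 * |B| / η + 1 with hC
  have hC0 : 0 < C := by positivity
  have hmod : ∀ x y, f x - ε ≤ f y + C * dist x y := by
    intro x y
    by_cases h : dist x y < η
    · have h1 := hηf h
      rw [Real.dist_eq] at h1
      have h2 : 0 ≤ C * dist x y := by positivity
      linarith [le_abs_self (f x - f y)]
    · rw [not_lt] at h
      have h1 : 2 * |B| ≤ C * dist x y := by
        calc 2 * |B| = 2 * |B| / η * η := by field_simp
          _ ≤ C * dist x y := by
            apply mul_le_mul _ h hη.le hC0.le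
            rw [hC]; linarith
      have h2 := abs_le.1 (hB x)
      have h3 := abs_le.1 (hB y)
      linarith [le_abs_self B]
  have hbdd : ∀ x, BddBelow (range fun y => f y + C * dist x y) := fun x =>
    ⟨f x - ε, by rintro _ ⟨y, rfl⟩; exact hmod x y⟩
  have hle : ∀ x z, (⨅ y, f y + C * dist x y) ≤ (⨅ y, f y + C * dist z y) + C * dist x z := by
    intro x z
    have : Nonempty X := ⟨x⟩
    rw [← sub_le_iff_le_add]
    refine le_ciInf fun y => ?_
    have h1 := ciInf_le (hbdd x) y
    have h2 : C * dist x y ≤ C * dist x z + C * dist z y := by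
      rw [← mul_add]; exact mul_le_mul_of_nonneg_left (dist_triangle _ _ _) hC0.le
    linarith
  refine ⟨fun x => ⨅ y, f y + C * dist x y, C, hC0, fun x => ?_, fun x z => ?_⟩
  · have : Nonempty X := ⟨x⟩
    have h1 := ciInf_le (hbdd x) x
    have h2 := le_ciInf (hmod x)
    rw [dist_self, mul_zero, add_zero] at h1
    rw [abs_le]
    constructor <;> linarith
  · rw [abs_le]
    have h1 := hle x z
    have h2 := hle z x
    rw [dist_comm] at h2
    constructor <;> linarith

/-! ### Ramps -/

theorem IsRamp.differentiable {δ : ℝ} {s : ℝ → ℝ} (hs : IsRamp δ s) : Differentiable ℝ s :=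
  hs.smooth.differentiable (by simp)

theorem IsRamp.continuous_deriv {δ : ℝ} {s : ℝ → ℝ} (hs : IsRamp δ s) : Continuous (deriv s) :=
  hs.smooth.continuous_deriv (by exact_mod_cast le_top)

/-- The endpoint 0 matters, as the level ρ = t may carry mass. There the derivative is computed from
within the closed half-line, where s is constant. -/
theorem IsRamp.deriv_eq_zero_of_nonpos {δ : ℝ} {s : ℝ → ℝ} (hs : IsRamp δ s) {τ : ℝ}
    (hτ : τ ≤ 0) : deriv s τ = 0 := by
  have hu : UniqueDiffWithinAt ℝ (Iic (0 : ℝ)) τ := uniqueDiffOn_Iic 0 τ hτ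
  rw [← (hs.differentiable τ).derivWithin hu,
    derivWithin_congr (s := Iic 0) (f := fun _ => (0 : ℝ)) (fun x hx => hs.eq_zero x hx) (hs.eq_zero τ hτ)]
  simp

theorem IsRamp.deriv_eq_zero_of_one_le {δ : ℝ} {s : ℝ → ℝ} (hs : IsRamp δ s) {τ : ℝ}
    (hτ : 1 ≤ τ) : deriv s τ = 0 := by
  have hu : UniqueDiffWithinAt ℝ (Ici (1 : ℝ)) τ := uniqueDiffOn_Ici 1 τ hτ
  rw [← (hs.differentiable τ).derivWithin hu,
    derivWithin_congr (s := Ici 1) (f := fun _ => (1 : ℝ)) (fun x hx => hs.eq_one x hx) (hs.eq_one τ hτ)]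
  simp

variable {E : Type*} [NormedAddCommGroup E] [InnerProductSpace ℝ E] [FiniteDimensional ℝ E]
  [MeasurableSpace E] [BorelSpace E] {m : ℕ} {U : Set E}

/-- The first component of the blow-up map. -/
def blowFun (ρ : E → ℝ) (t δ : ℝ) (s : ℝ → ℝ) (x : E) : ℝ := s ((t - ρ x) / δ)

theorem blowMap_eq (ρ : E → ℝ) (t δ : ℝ) (s : ℝ → ℝ) :
    blowMap ρ t δ s = graphMap (blowFun ρ t δ s) := rfl

theorem contDiffOn_blowFun {ρ : E → ℝ} {t δ : ℝ} {s : ℝ → ℝ} (hs : IsRamp δ s)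
    (hρ : ContDiffOn ℝ 1 ρ U) : ContDiffOn ℝ 1 (blowFun ρ t δ s) U :=
  (hs.smooth.of_le (by exact_mod_cast le_top)).comp_contDiffOn
    ((contDiffOn_const.sub hρ).div_const δ)

theorem fderiv_blowFun (hU : IsOpen U) {ρ : E → ℝ} {t δ : ℝ} {s : ℝ → ℝ} (hs : IsRamp δ s)
    (hρ : ContDiffOn ℝ 1 ρ U) {x : E} (hx : x ∈ U) :
    fderiv ℝ (blowFun ρ t δ s) x = (-(deriv s ((t - ρ x) / δ) / δ)) • fderiv ℝ ρ x := by
  have h1 := ((hρ.differentiableOn one_ne_zero).differentiableAt (hU.mem_nhds hx)).hasFDerivAt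
  have h2 := (h1.const_sub t).mul_const δ⁻¹
  have h3 := ((hs.differentiable ((t - ρ x) * δ⁻¹)).hasDerivAt.comp_hasFDerivAt x h2).fderiv
  have h4 : blowFun ρ t δ s = s ∘ fun y => (t - ρ y) * δ⁻¹ := by
    funext y; simp [blowFun, div_eq_mul_inv]
  rw [h4, h3, smul_neg, smul_neg, smul_smul, neg_smul, div_eq_mul_inv, div_eq_mul_inv]

theorem graphJac_of_fderiv_eq_zero {h : E → ℝ} {p : E × Grass E m} (hp : fderiv ℝ h p.1 = 0) :
    graphJac h p = 1 := by
  rw [graphJac, hp, jac_graphCLM]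
  simp

/-! ### Admissible integrands -/

/-- Continuous integrands on `ℝ × E` with bound `C` that vanish off `ℝ × K`. -/
structure IsAdmissible (C : ℝ) (K : Set E)
    (α : WithLp 2 (ℝ × E) × Grass (WithLp 2 (ℝ × E)) m → ℝ) : Prop where
  cont : Continuous α
  bound : ∀ q, |α q| ≤ C
  supp : ∀ q, q.1.snd ∉ K → α q = 0

theorem IsTest.isAdmissible {α : WithLp 2 (ℝ × E) × Grass (WithLp 2 (ℝ × E)) m → ℝ}
    (hα : IsTest (realProd U) α) :
    ∃ (C : ℝ) (K : Set E), 0 < C ∧ IsCompact K ∧ K ⊆ U ∧ IsAdmissible C K α := by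
  obtain ⟨C, hC0, hC⟩ := hα.exists_bound
  obtain ⟨K, hKU, hK, h0⟩ := hα.exists_compact
  refine ⟨C, sndCLM '' K, hC0, hK.image sndCLM.continuous, ?_, hα.cont, hC, fun q hq => ?_⟩
  · rintro _ ⟨x, hx, rfl⟩; exact hKU hx
  · exact h0 q fun h => hq ⟨_, h, rfl⟩

theorem IsAdmissible.integrable_graph (hU : IsOpen U) {h : E → ℝ} (hh : ContDiffOn ℝ 1 h U)
    {V : Measure (E × Grass E m)} (hV : IsVarifold U V) {C : ℝ} {K : Set E} (hK : IsCompact K)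
    (hKU : K ⊆ U) {α : WithLp 2 (ℝ × E) × Grass (WithLp 2 (ℝ × E)) m → ℝ}
    (hα : IsAdmissible C K α) : Integrable (fun p => graphJac h p * α (graphPoint h p)) V := by
  obtain ⟨J, hJ0, hJ⟩ := exists_graphJac_bound (m := m) hU hh hK hKU
  have h0 : ∀ p : E × Grass E m, p.1 ∉ K → graphJac h p * α (graphPoint h p) = 0 :=
    fun p hp => by rw [hα.supp (graphPoint h p) hp, mul_zero]
  refine hV.integrable (C := J * C) ?_ hK hKU (fun p => ?_) h0
  · exact ((measurable_graphJac h).aemeasurable.mul (hα.cont.measurable.comp_aemeasurable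
      (aemeasurable_graphPoint hU hh.continuousOn hV))).aestronglyMeasurable
  · have hC0 : 0 ≤ C := (abs_nonneg _).trans (hα.bound (graphPoint h p))
    by_cases hp : p.1 ∈ K
    · rw [abs_mul, abs_of_nonneg (graphJac_nonneg h p)]
      exact mul_le_mul (hJ p hp) (hα.bound _) (abs_nonneg _) hJ0.le
    · rw [h0 p hp, abs_zero]; positivity

/-- The integral of `α` over the vertical cylinder above `W` at height `τ`. -/
def cylIntegral (W : Measure (E × Grass E m))
    (α : WithLp 2 (ℝ × E) × Grass (WithLp 2 (ℝ × E)) (m + 1) → ℝ) (τ : ℝ) : ℝ :=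
  ∫ p, α (WithLp.toLp 2 (τ, p.1), cyl p.2) ∂W

theorem IsAdmissible.integrable_cyl {W : Measure (E × Grass E m)} (hW : IsVarifold U W) {C : ℝ}
    {K : Set E} (hK : IsCompact K) (hKU : K ⊆ U)
    {α : WithLp 2 (ℝ × E) × Grass (WithLp 2 (ℝ × E)) (m + 1) → ℝ} (hα : IsAdmissible C K α)
    (τ : ℝ) : Integrable (fun p : E × Grass E m => α (WithLp.toLp 2 (τ, p.1), cyl p.2)) W :=
  hW.integrable ((hα.cont.comp (continuous_toLp_cyl.comp
    (continuous_const.prodMk continuous_id))).aestronglyMeasurable) hK hKU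
    (fun _ => hα.bound _) fun p hp => hα.supp (WithLp.toLp 2 (τ, p.1), cyl p.2) hp

theorem IsAdmissible.continuous_cylIntegral {W : Measure (E × Grass E m)} (hW : IsVarifold U W)
    {C : ℝ} {K : Set E} (hK : IsCompact K) (hKU : K ⊆ U)
    {α : WithLp 2 (ℝ × E) × Grass (WithLp 2 (ℝ × E)) (m + 1) → ℝ} (hα : IsAdmissible C K α) :
    Continuous (cylIntegral W α) := by
  have hKm : MeasurableSet (K ×ˢ univ : Set (E × Grass E m)) :=
    hK.measurableSet.prod MeasurableSet.univ
  refine continuous_of_dominated (bound := (K ×ˢ univ).indicator fun _ => C)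
    (fun τ => (hα.integrable_cyl hW hK hKU τ).aestronglyMeasurable)
    (fun τ => ae_of_all _ fun p => ?_) ?_ (ae_of_all _ fun p => ?_)
  · by_cases hp : p.1 ∈ K
    · rw [indicator_of_mem (show p ∈ K ×ˢ univ from ⟨hp, trivial⟩)]
      exact hα.bound _
    · rw [hα.supp (WithLp.toLp 2 (τ, p.1), cyl p.2) hp, norm_zero, indicator_of_notMem fun h => hp h.1]
  · rw [integrable_indicator_iff hKm]
    exact integrableOn_const (hW.finite_on_compacts K hKU hK).ne
  · exact hα.cont.comp (continuous_toLp_cyl.comp (continuous_id.prodMk continuous_const))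

/-- Substitution τ = s((t - u)/δ), which runs from 1 down to 0; the reversed orientation absorbs the
sign of the derivative. Injectivity of s plays no role. -/
theorem integral_ramp_comp {δ t : ℝ} (hδ : 0 < δ) {s w : ℝ → ℝ} (hs : IsRamp δ s)
    (hw : Continuous w) :
    ∫ u in Ioo (t - δ) t, deriv s ((t - u) / δ) / δ * w (s ((t - u) / δ))
      = ∫ τ in Icc (0 : ℝ) 1, w τ := by
  have hd : ∀ u ∈ uIcc (t - δ) t, HasDerivAt (fun u => s ((t - u) / δ))
      (-(deriv s ((t - u) / δ) / δ)) u := by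
    intro u _
    have h1 : HasDerivAt (fun u => (t - u) / δ) (-1 / δ) u :=
      ((hasDerivAt_id u).const_sub t).div_const δ
    have h2 := (hs.differentiable ((t - u) / δ)).hasDerivAt.comp u h1
    have h3 : deriv s ((t - u) / δ) * (-1 / δ) = -(deriv s ((t - u) / δ) / δ) := by ring
    rwa [h3] at h2
  have hc : Continuous fun u : ℝ => (t - u) / δ := by fun_prop
  have h := intervalIntegral.integral_comp_mul_deriv hd
    ((hs.continuous_deriv.comp hc).div_const δ).neg.continuousOn hw
  have e1 : s ((t - (t - δ)) / δ) = 1 := hs.eq_one _ (by rw [sub_sub_cancel, div_self hδ.ne'])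
  have e2 : s ((t - t) / δ) = 0 := hs.eq_zero _ (by simp)
  rw [e1, e2, intervalIntegral.integral_symm (0 : ℝ) 1, intervalIntegral.integral_of_le (by linarith),
    intervalIntegral.integral_of_le zero_le_one, integral_Ioc_eq_integral_Ioo,
    ← integral_Icc_eq_integral_Ioc] at h
  rw [← neg_inj, ← h, ← integral_neg]
  refine integral_congr_ae (ae_of_all _ fun u => ?_)
  simp only [Function.comp_apply]
  ring
end

section
variable {E : Type*} [NormedAddCommGroup E] [InnerProductSpace ℝ E] [FiniteDimensional ℝ E]
  [MeasurableSpace E] [BorelSpace E] {m : ℕ} {U : Set E}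

/-! ### Blow-up near the level -/

/-- Write Jα(A) - lα(B) = J(α(A) - α(B)) + (J - l)α(B). The first term is at most 3C by the
comparison of planes, the second at most C since J ≤ l + 1. The bound does not involve c, which will
be of order 1/δ. -/
theorem abs_jac_mul_sub_le [Nonempty (Grass E m)] (D : E →L[ℝ] ℝ) (c : ℝ) (S : Grass E (m + 1))
    {C : ℝ} (hC : 0 < C) {α : WithLp 2 (ℝ × E) × Grass (WithLp 2 (ℝ × E)) (m + 1) → ℝ}
    (hb : ∀ q, |α q| ≤ C) (hl : ∀ q q', |α q - α q'| ≤ C * dist q q') (y : WithLp 2 (ℝ × E)) :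
    |jac (graphCLM (c • D)) S.space * α (y, graphImg (c • D, S))
      - |c| * ‖D.comp S.space.starProjection‖ * α (y, cyl (kerInter (D, S)))| ≤ 4 * C := by
  have hn : |c| * ‖D.comp S.space.starProjection‖ = ‖tanGrad (c • D) S.space‖ := by
    rw [norm_tanGrad, ContinuousLinearMap.smul_comp, norm_smul, Real.norm_eq_abs]
  rw [hn]
  by_cases h : tanGrad (c • D) S.space = 0
  · rw [jac_graphCLM, ← norm_tanGrad, h]
    simp only [norm_zero, ne_eq, OfNat.ofNat_ne_zero, not_false_eq_true, zero_pow, add_zero,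
      Real.sqrt_one, one_mul, zero_mul, sub_zero]
    exact (hb _).trans (by linarith)
  · have hc : c ≠ 0 := by
      rintro rfl
      apply h
      rw [← norm_eq_zero, norm_tanGrad]
      simp
    -- Scaling by c ≠ 0 leaves the kernel unchanged, so the vertical plane depends on D alone.
    rw [← kerInter_smul (g := D) S hc]
    have h1 := jac_mul_dist_le h
    set l := ‖tanGrad (c • D) S.space‖ with hl'
    set J := jac (graphCLM (c • D)) S.space with hJ
    have hJl : J = Real.sqrt (1 + l ^ 2) := by rw [hJ, jac_graphCLM, hl', norm_tanGrad]
    have hl0 : 0 ≤ l := norm_nonneg _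
    have hJ2 : J ^ 2 = 1 + l ^ 2 := by rw [hJl]; exact Real.sq_sqrt (by positivity)
    have hJ0 : 0 ≤ J := by rw [hJl]; exact Real.sqrt_nonneg _
    have hlJ : l ≤ J := by nlinarith
    have hJ1 : J ≤ l + 1 := by nlinarith
    set A := graphImg (c • D, S)
    set B := cyl (kerInter (c • D, S))
    have h2 : |α (y, A) - α (y, B)| ≤ C * dist A B := by
      refine (hl _ _).trans_eq ?_
      rw [Prod.dist_eq, dist_self, max_eq_right dist_nonneg]
    have h3 : J * α (y, A) - l * α (y, B) = J * (α (y, A) - α (y, B)) + (J - l) * α (y, B) := by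
      ring
    rw [h3]
    refine (abs_add_le _ _).trans ?_
    rw [abs_mul, abs_mul, abs_of_nonneg hJ0, abs_of_nonneg (sub_nonneg.2 hlJ)]
    have h4 : J * |α (y, A) - α (y, B)| ≤ 3 * C := by
      calc J * |α (y, A) - α (y, B)| ≤ J * (C * dist A B) := mul_le_mul_of_nonneg_left h2 hJ0
        _ = C * (J * dist A B) := by ring
        _ ≤ C * 3 := mul_le_mul_of_nonneg_left h1 hC.le
        _ = 3 * C := by ring
    have h5 : (J - l) * |α (y, B)| ≤ 1 * C :=
      mul_le_mul (by linarith) (hb _) (abs_nonneg _) zero_le_one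
    linarith

/-- The integrand over `(V, ρ)` to which the blow-up reduces. -/
def blowFamily (t δ : ℝ) (s : ℝ → ℝ)
    (α : WithLp 2 (ℝ × E) × Grass (WithLp 2 (ℝ × E)) (m + 1) → ℝ) (u : ℝ) (p : E × Grass E m) :
    ℝ :=
  deriv s ((t - u) / δ) / δ * α (WithLp.toLp 2 (s ((t - u) / δ), p.1), cyl p.2)

theorem isTestFamily_blowFamily {t δ : ℝ} {s : ℝ → ℝ} (hs : IsRamp δ s) (hδ : δ ∈ Ioo (0 : ℝ) 1)
    {C : ℝ} (hC : 0 < C) {K : Set E}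
    {α : WithLp 2 (ℝ × E) × Grass (WithLp 2 (ℝ × E)) (m + 1) → ℝ} (hα : IsAdmissible C K α)
    (hl : ∀ q q', |α q - α q'| ≤ C * dist q q') :
    IsTestFamily (2 * C / δ) K (blowFamily t δ s α) := by
  have hδ0 := hδ.1
  have hc : Continuous fun u : ℝ => (t - u) / δ := by fun_prop
  -- From s' ≤ 1 + δ and δ < 1.
  have hd : ∀ τ, |deriv s τ / δ| ≤ 2 / δ := fun τ => by
    rw [abs_of_nonneg (div_nonneg (hs.deriv_mem τ).1 hδ0.le)]
    exact div_le_div_of_nonneg_right ((hs.deriv_mem τ).2.trans (by linarith [hδ.2])) hδ0.le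
  refine ⟨?_, fun u p => ?_, fun u p q => ?_, fun u p hp => ?_⟩
  · refine Continuous.measurable ?_
    have h1 : Continuous fun q : ℝ × E × Grass E m => deriv s ((t - q.1) / δ) / δ :=
      ((hs.continuous_deriv.comp hc).div_const δ).comp continuous_fst
    have h2 : Continuous fun q : ℝ × E × Grass E m => (s ((t - q.1) / δ), q.2) :=
      ((hs.differentiable.continuous.comp hc).comp continuous_fst).prodMk continuous_snd
    exact h1.mul (hα.cont.comp (continuous_toLp_cyl.comp h2))
  · rw [blowFamily, abs_mul, mul_div_right_comm]
    exact mul_le_mul (hd _) (hα.bound _) (abs_nonneg _) (by positivity)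
  · rw [blowFamily, blowFamily, ← mul_sub, abs_mul, mul_div_right_comm, mul_assoc]
    refine mul_le_mul (hd _) ((hl _ _).trans (mul_le_mul_of_nonneg_left ?_ hC.le)) (abs_nonneg _)
      (by positivity)
    rw [Prod.dist_eq, Prod.dist_eq]
    refine max_le_max (le_of_eq ?_) (dist_cyl_le _ _)
    rw [dist_eq_norm, dist_eq_norm, ← WithLp.toLp_sub, Prod.mk_sub_mk, sub_self,
      WithLp.norm_toLp_snd]
  · rw [blowFamily, hα.supp (WithLp.toLp 2 (s ((t - u) / δ), p.1), cyl p.2) hp, mul_zero]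

variable [Nonempty (Grass E m)] {ρ : E → ℝ} {V : Measure (E × Grass E (m + 1))} {t : ℝ}

theorem measure_strip_lt_top (hp : IsProperMap (U.domRestrict ρ)) (hV : IsVarifold U V) {B : Set ℝ}
    {a b : ℝ} (hB : B ⊆ Icc a b) : V (strip U ρ B) < ∞ := by
  rw [strip_eq]
  refine (measure_mono (prod_mono (inter_subset_inter_right _ (preimage_mono hB)) subset_rfl)).trans_lt
    (hV.finite_on_compacts _ inter_subset_left (isCompact_inter_preimage_Icc hp a b))

theorem abs_setIntegral_blow_sub_le (hU : IsOpen U) (hρ : ContDiffOn ℝ 1 ρ U)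
    (hp : IsProperMap (U.domRestrict ρ)) (hV : IsVarifold U V) {δ : ℝ} {s : ℝ → ℝ}
    (hs : IsRamp δ s) (hδ : δ ∈ Ioo (0 : ℝ) 1) {C : ℝ} (hC : 0 < C) {K : Set E} (hK : IsCompact K)
    (hKU : K ⊆ U)
    {α : WithLp 2 (ℝ × E) × Grass (WithLp 2 (ℝ × E)) (m + 1) → ℝ} (hα : IsAdmissible C K α)
    (hl : ∀ q q', |α q - α q'| ≤ C * dist q q') :
    |∫ p in strip U ρ (Ioo (t - δ) t), graphJac (blowFun ρ t δ s) p
          * α (graphPoint (blowFun ρ t δ s) p) ∂V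
        - ∫ p in strip U ρ (Ioo (t - δ) t), blowFamily t δ s α (ρ p.1) p ∂(sliceMeasure V ρ)|
      ≤ 4 * C * V.real (strip U ρ (Ioo (t - δ) t)) := by
  have hcd := contDiffOn_blowFun (t := t) hs hρ
  set h := blowFun ρ t δ s with hh
  have hSm : MeasurableSet (U ∩ ρ ⁻¹' Ioo (t - δ) t) :=
    measurableSet_inter_preimage hU hρ.continuousOn measurableSet_Ioo
  have hSfin : V (strip U ρ (Ioo (t - δ) t)) < ∞ := measure_strip_lt_top hp hV Ioo_subset_Icc_self
  have hF := isTestFamily_blowFamily (t := t) hs hδ hC hα hl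
  -- Extending ρ by zero makes the integrand measurable on the whole space; on the strip nothing
  -- changes.
  obtain ⟨φ, hφ⟩ : ∃ φ : E × Grass E m → ℝ,
      φ = fun p => blowFamily t δ s α (U.indicator ρ p.1) p := ⟨_, rfl⟩
  have hφm : Measurable φ := by
    rw [hφ]
    exact hF.meas.comp (measurable_indicator_prodMk hU hρ)
  have e1 : ∫ p in strip U ρ (Ioo (t - δ) t), blowFamily t δ s α (ρ p.1) p ∂(sliceMeasure V ρ)
      = ∫ p in strip U ρ (Ioo (t - δ) t), sliceDensity ρ p * φ (slicePoint ρ p) ∂V := by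
    have h1 := setIntegral_sliceMeasure V ρ hSm hφm
    rw [← strip_eq, ← strip_eq] at h1
    rw [← h1]
    refine setIntegral_congr_fun (measurableSet_strip hU hρ.continuousOn measurableSet_Ioo)
      fun p hp => ?_
    simp [hφ, hp.1]
  rw [e1]
  have hi1 : Integrable (fun p => graphJac h p * α (graphPoint h p))
      (V.restrict (strip U ρ (Ioo (t - δ) t))) :=
    (hα.integrable_graph hU hcd hV hK hKU).restrict
  have hdiff : ∀ p ∈ (strip U ρ (Ioo (t - δ) t) : Set (E × Grass E (m + 1))),
      |graphJac h p * α (graphPoint h p) - sliceDensity ρ p * φ (slicePoint ρ p)| ≤ 4 * C := by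
    intro p hp
    have h1 := abs_jac_mul_sub_le (fderiv ℝ ρ p.1) (-(deriv s ((t - ρ p.1) / δ) / δ)) p.2 hC
      hα.bound hl (graphMap h p.1)
    -- Monotonicity of the ramp enters here: |c| = s'/δ, exactly the weight in `blowFamily`.
    rw [← fderiv_blowFun hU hs hρ hp.1, abs_neg,
      abs_of_nonneg (div_nonneg (hs.deriv_mem _).1 hδ.1.le)] at h1
    have h2 : φ (slicePoint ρ p) = deriv s ((t - ρ p.1) / δ) / δ
        * α (graphMap h p.1, cyl (kerInter (fderiv ℝ ρ p.1, p.2))) := by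
      rw [hφ]
      simp only [slicePoint, indicator_of_mem hp.1, blowFamily, graphMap, hh, blowFun]
    rw [h2, mul_left_comm, ← mul_assoc]
    exact h1
  have hi2 : Integrable (fun p => sliceDensity ρ p * φ (slicePoint ρ p))
      (V.restrict (strip U ρ (Ioo (t - δ) t))) := by
    have hm : Measurable fun p : E × Grass E (m + 1) => sliceDensity ρ p * φ (slicePoint ρ p) :=
      (measurable_sliceDensity ρ).mul (hφm.comp (measurable_slicePoint ρ))
    have : IsFiniteMeasure (V.restrict (strip U ρ (Ioo (t - δ) t))) :=
      ⟨by rwa [Measure.restrict_apply_univ]⟩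
    -- Integrability is inherited from the first integrand, from which this one differs by at most
    -- 4C on a set of finite mass.
    refine (hi1.abs.add (integrable_const (4 * C))).mono' hm.aestronglyMeasurable ?_
    filter_upwards [ae_restrict_mem (measurableSet_strip hU hρ.continuousOn measurableSet_Ioo)]
      with p hp
    have h1 := hdiff p hp
    rw [abs_sub_comm] at h1
    have h2 := abs_sub_abs_le_abs_sub (sliceDensity ρ p * φ (slicePoint ρ p))
      (graphJac h p * α (graphPoint h p))
    rw [Real.norm_eq_abs, Pi.add_apply]
    linarith
  rw [← integral_sub hi1 hi2]
  exact norm_setIntegral_le_of_norm_le_const (f := fun p => graphJac h p * α (graphPoint h p)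
    - sliceDensity ρ p * φ (slicePoint ρ p)) hSfin fun p hp => hdiff p hp

theorem tendsto_setIntegral_blow_of_lipschitz (hU : IsOpen U) (hρ : ContDiffOn ℝ 1 ρ U)
    (hp : IsProperMap (U.domRestrict ρ)) (hV : IsVarifold U V)
    (ht : IsLebesguePoint (m := m) U V ρ t)
    (hlim : Tendsto (fun δ : ℝ => V (strip U ρ (Ico (t - δ) t))) (𝓝[>] 0) (𝓝 0))
    {s : ℝ → ℝ → ℝ} (hs : ∀ δ ∈ Ioo (0 : ℝ) 1, IsRamp δ (s δ)) {C : ℝ} (hC : 0 < C) {K : Set E}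
    (hK : IsCompact K) (hKU : K ⊆ U)
    {α : WithLp 2 (ℝ × E) × Grass (WithLp 2 (ℝ × E)) (m + 1) → ℝ} (hα : IsAdmissible C K α)
    (hl : ∀ q q', |α q - α q'| ≤ C * dist q q') :
    Tendsto (fun δ => ∫ p in strip U ρ (Ioo (t - δ) t), graphJac (blowFun ρ t δ (s δ)) p
        * α (graphPoint (blowFun ρ t δ (s δ)) p) ∂V)
      (𝓝[>] 0) (𝓝 (∫ τ in Icc (0 : ℝ) 1, cylIntegral (slice U V ρ t) α τ)) := by
  obtain ⟨ω, hω, hmod⟩ := exists_modulus_of_isLebesguePoint hU hρ hp hV ht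
  obtain ⟨⟨W₀, hW₀⟩, -⟩ := ht
  have hW := (isSlice_slice hW₀).1
  set W := slice U V ρ t
  set T₀ := ∫ τ in Icc (0 : ℝ) 1, cylIntegral W α τ
  set T : ℝ → ℝ := fun δ => ∫ p in strip U ρ (Ioo (t - δ) t),
    graphJac (blowFun ρ t δ (s δ)) p * α (graphPoint (blowFun ρ t δ (s δ)) p) ∂V
  have hbound : ∀ᶠ δ : ℝ in 𝓝[>] 0, ENNReal.ofReal |T δ - T₀|
      ≤ ENNReal.ofReal (4 * C) * V (strip U ρ (Ico (t - δ) t))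
        + ENNReal.ofReal (2 * C) * (ω δ / ENNReal.ofReal δ) := by
    filter_upwards [Ioo_mem_nhdsGT (zero_lt_one' ℝ)] with δ hδ
    have hδ0 := hδ.1
    have h1 := abs_setIntegral_blow_sub_le (t := t) hU hρ hp hV (hs δ hδ) hδ hC hK hKU hα hl
    have h2 := hmod δ hδ (2 * C / δ) (by positivity) K hK hKU _
      (isTestFamily_blowFamily (t := t) (hs δ hδ) hδ hC hα hl)
    have h3 : ∫ u in Ioo (t - δ) t, ∫ p, blowFamily t δ (s δ) α u p ∂W = T₀ := by
      refine Eq.trans (integral_congr_ae (ae_of_all _ fun u => ?_))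
        (integral_ramp_comp (t := t) hδ0 (hs δ hδ) (hα.continuous_cylIntegral hW hK hKU))
      simp only [blowFamily, cylIntegral]
      rw [integral_const_mul]
    rw [h3] at h2
    have h4 := abs_sub_le (T δ) (∫ p in strip U ρ (Ioo (t - δ) t),
      blowFamily t δ (s δ) α (ρ p.1) p ∂(sliceMeasure V ρ)) T₀
    refine (ENNReal.ofReal_le_ofReal h4).trans (ENNReal.ofReal_add_le.trans (add_le_add ?_ ?_))
    · refine (ENNReal.ofReal_le_ofReal h1).trans ?_
      rw [ENNReal.ofReal_mul (by positivity), ofReal_measureReal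
        (measure_strip_lt_top hp hV Ioo_subset_Icc_self).ne]
      gcongr
      exact fun p hp => ⟨hp.1, Ioo_subset_Ico_self hp.2⟩
    · refine h2.trans_eq ?_
      -- The 1/δ in the constant 2C/δ of the family becomes the normalisation of ω(δ).
      rw [ENNReal.ofReal_div_of_pos hδ0, ENNReal.div_eq_inv_mul, ENNReal.div_eq_inv_mul]
      ring
  have hz : Tendsto (fun δ => ENNReal.ofReal |T δ - T₀|) (𝓝[>] 0) (𝓝 0) := by
    refine tendsto_of_tendsto_of_tendsto_of_le_of_le' tendsto_const_nhds ?_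
      (Eventually.of_forall fun _ => zero_le) hbound
    have h1 := ENNReal.Tendsto.const_mul hlim (a := ENNReal.ofReal (4 * C))
      (Or.inr ENNReal.ofReal_ne_top)
    have h2 := ENNReal.Tendsto.const_mul hω (a := ENNReal.ofReal (2 * C))
      (Or.inr ENNReal.ofReal_ne_top)
    rw [mul_zero] at h1 h2
    simpa using h1.add h2
  rw [tendsto_iff_dist_tendsto_zero]
  have := (ENNReal.tendsto_toReal ENNReal.zero_ne_top).comp hz
  refine this.congr fun δ => ?_
  rw [Function.comp_apply, ENNReal.toReal_ofReal (abs_nonneg _), Real.dist_eq]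

theorem tendsto_setIntegral_blow (hU : IsOpen U) (hρ : ContDiffOn ℝ 1 ρ U)
    (hp : IsProperMap (U.domRestrict ρ)) (hV : IsVarifold U V)
    (ht : IsLebesguePoint (m := m) U V ρ t)
    (hlim : Tendsto (fun δ : ℝ => V (strip U ρ (Ico (t - δ) t))) (𝓝[>] 0) (𝓝 0))
    {s : ℝ → ℝ → ℝ} (hs : ∀ δ ∈ Ioo (0 : ℝ) 1, IsRamp δ (s δ))
    {α : WithLp 2 (ℝ × E) × Grass (WithLp 2 (ℝ × E)) (m + 1) → ℝ} (hα : IsTest (realProd U) α) :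
    Tendsto (fun δ => ∫ p in strip U ρ (Ioo (t - δ) t), graphJac (blowFun ρ t δ (s δ)) p
        * α (graphPoint (blowFun ρ t δ (s δ)) p) ∂V)
      (𝓝[>] 0) (𝓝 (∫ τ in Icc (0 : ℝ) 1, cylIntegral (slice U V ρ t) α τ)) := by
  have hlip := @tendsto_setIntegral_blow_of_lipschitz E _ _ _ _ _ m U _ ρ V t hU hρ hp hV ht
    hlim s hs
  obtain ⟨⟨W₀, hW₀⟩, -⟩ := ht
  have hW := (isSlice_slice hW₀).1
  set W := slice U V ρ t
  obtain ⟨B, K₁, hB, hK₁, hK₁U, hαB⟩ := hα.isAdmissible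
  obtain ⟨χ, C, K, hC, hχ0, hχ1, hχK, hK, hKU, hχs, hχl⟩ := exists_lipschitz_cutoff hU hK₁ hK₁U
  have hαK : IsAdmissible B K α := ⟨hαB.cont, hαB.bound, fun q hq =>
    hαB.supp q fun h => by simpa [hχs _ hq] using hχK _ h⟩
  have hdist : ∀ q q' : WithLp 2 (ℝ × E) × Grass (WithLp 2 (ℝ × E)) (m + 1),
      |χ q.1.snd - χ q'.1.snd| ≤ C * dist q q' := fun q q' => by
    refine (hχl _ _).trans (mul_le_mul_of_nonneg_left ?_ hC.le)
    rw [Prod.dist_eq]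
    refine le_trans ?_ (le_max_left _ _)
    rw [dist_eq_norm, dist_eq_norm, ← WithLp.sub_snd]
    exact WithLp.norm_snd_le ℝ _
  have hcont : ∀ (f : WithLp 2 (ℝ × E) × Grass (WithLp 2 (ℝ × E)) (m + 1) → ℝ) (C : ℝ),
      (∀ q q', |f q - f q'| ≤ C * dist q q') → Continuous f := fun f C hf =>
    (LipschitzWith.of_dist_le_mul (K := C.toNNReal) fun p q => by
      rw [Real.dist_eq]
      exact (hf p q).trans (mul_le_mul_of_nonneg_right (Real.le_coe_toNNReal C)
        dist_nonneg)).continuous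
  have hχA : ∀ C' ≥ (1 : ℝ), IsAdmissible (m := m + 1) C' K fun q => χ q.1.snd := fun C' hC' =>
    ⟨hcont _ C hdist, fun q => by rw [abs_of_nonneg (hχ0 _)]; exact (hχ1 _).trans hC',
      fun q hq => hχs _ hq⟩
  -- The cutoff, itself an admissible Lipschitz integrand, bounds the pushed mass over K₁ from the
  -- strip uniformly for small δ.
  have hχlim := hlip (C := max C 1) (by positivity) hK hKU (hχA _ (le_max_right _ _))
    fun q q' => (hdist q q').trans (mul_le_mul_of_nonneg_right (le_max_left _ _) dist_nonneg)
  have hχT : ∫ τ in Icc (0 : ℝ) 1, cylIntegral W (fun q => χ q.1.snd) τ = ∫ p, χ p.1 ∂W := by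
    simp [cylIntegral]
  rw [hχT] at hχlim
  set I := ∫ p, χ p.1 ∂W
  have hI : 0 ≤ I := integral_nonneg fun p => hχ0 _
  rw [Metric.tendsto_nhds]
  intro η hη
  -- The errors are εI for the limit, ε for the convergence of g, and ε(I + 1) over the strip: less
  -- than ε(2I + 3) in all.
  set ε := η / (2 * I + 3) with hε
  have hε0 : 0 < ε := by positivity
  obtain ⟨f, Cf, hCf, hαf, hfl⟩ := exists_lipschitz_approximation
    (hα.cont.uniformContinuous_of_tendsto_cocompact (x := 0) hα.compact.is_zero_at_infty)
    hαB.bound hε0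
  have hfb : ∀ q, |f q| ≤ B + ε := fun q => by
    have h1 := abs_sub_abs_le_abs_sub (f q) (α q)
    have h2 := hαf q
    rw [abs_sub_comm] at h2
    linarith [hαB.bound q]
  -- Multiplication by χ restores the support lost in the Lipschitz approximation and turns the
  -- uniform error ε into εχ, which is integrable.
  set g : WithLp 2 (ℝ × E) × Grass (WithLp 2 (ℝ × E)) (m + 1) → ℝ :=
    fun q => χ q.1.snd * f q with hg
  have hgl : ∀ q q', |g q - g q'| ≤ (Cf + C * (B + ε)) * dist q q' := fun q q' => by
    have h1 : g q - g q' = χ q.1.snd * (f q - f q') + (χ q.1.snd - χ q'.1.snd) * f q' := by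
      rw [hg]; ring
    rw [h1]
    refine (abs_add_le _ _).trans ?_
    rw [abs_mul, abs_mul, abs_of_nonneg (hχ0 _)]
    have h2 : χ q.1.snd * |f q - f q'| ≤ 1 * (Cf * dist q q') :=
      mul_le_mul (hχ1 _) (hfl _ _) (abs_nonneg _) zero_le_one
    have h3 : |χ q.1.snd - χ q'.1.snd| * |f q'| ≤ C * dist q q' * (B + ε) :=
      mul_le_mul (hdist _ _) (hfb _) (abs_nonneg _) (by positivity)
    linarith
  set Cg := max (Cf + C * (B + ε)) (B + ε) with hCg
  have hCg0 : 0 < Cg := lt_max_of_lt_right (by positivity)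
  have hgA : IsAdmissible Cg K g := by
    refine ⟨hcont _ _ hgl, fun q => ?_, fun q hq => by rw [hg]; simp [hχs _ hq]⟩
    rw [hg, abs_mul, abs_of_nonneg (hχ0 _)]
    exact ((mul_le_mul (hχ1 _) (hfb q) (abs_nonneg _) zero_le_one).trans_eq (one_mul _)).trans
      (le_max_right _ _)
  have hglim := hlip hCg0 hK hKU hgA fun q q' =>
    (hgl q q').trans (mul_le_mul_of_nonneg_right (le_max_left _ _) dist_nonneg)
  have hαg : ∀ q, |α q - g q| ≤ ε * χ q.1.snd := fun q => by
    have h1 : α q = χ q.1.snd * α q := by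
      by_cases hq : q.1.snd ∈ K₁
      · rw [hχK _ hq, one_mul]
      · rw [hαB.supp q hq, mul_zero]
    rw [hg, h1, ← mul_sub, abs_mul, abs_of_nonneg (hχ0 _), mul_comm]
    exact mul_le_mul_of_nonneg_right (hαf q) (hχ0 _)
  have hT0 : |(∫ τ in Icc (0 : ℝ) 1, cylIntegral W α τ)
      - ∫ τ in Icc (0 : ℝ) 1, cylIntegral W g τ| ≤ ε * I := by
    rw [← integral_sub (hαK.continuous_cylIntegral hW hK hKU).continuousOn.integrableOn_Icc
      (hgA.continuous_cylIntegral hW hK hKU).continuousOn.integrableOn_Icc]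
    have h1 : ∀ τ ∈ Icc (0 : ℝ) 1, ‖cylIntegral W α τ - cylIntegral W g τ‖ ≤ ε * I := by
      intro τ _
      rw [cylIntegral, cylIntegral, ← integral_sub (hαK.integrable_cyl hW hK hKU τ)
        (hgA.integrable_cyl hW hK hKU τ), Real.norm_eq_abs, ← integral_const_mul]
      exact abs_integral_le_integral_abs.trans (integral_mono
        ((hαK.integrable_cyl hW hK hKU τ).sub (hgA.integrable_cyl hW hK hKU τ)).abs
        (((hχA 1 le_rfl).integrable_cyl hW hK hKU τ).const_mul ε) fun p => hαg _)
    have h2 := norm_setIntegral_le_of_norm_le_const (μ := volume) measure_Icc_lt_top h1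
    rwa [Real.volume_real_Icc, sub_zero, max_eq_left zero_le_one, mul_one] at h2
  filter_upwards [Ioo_mem_nhdsGT (zero_lt_one' ℝ), Metric.tendsto_nhds.1 hglim ε hε0,
    Metric.tendsto_nhds.1 hχlim 1 one_pos] with δ hδ h1 h2
  have hcd := contDiffOn_blowFun (t := t) (hs δ hδ) hρ
  set h := blowFun ρ t δ (s δ)
  have i1 := (hαK.integrable_graph hU hcd hV hK hKU).restrict (s := strip U ρ (Ioo (t - δ) t))
  have i2 := (hgA.integrable_graph hU hcd hV hK hKU).restrict (s := strip U ρ (Ioo (t - δ) t))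
  have i3 := ((hχA 1 le_rfl).integrable_graph hU hcd hV hK hKU).restrict
    (s := strip U ρ (Ioo (t - δ) t))
  have hTd : |(∫ p in strip U ρ (Ioo (t - δ) t), graphJac h p * α (graphPoint h p) ∂V)
      - ∫ p in strip U ρ (Ioo (t - δ) t), graphJac h p * g (graphPoint h p) ∂V|
      ≤ ε * ∫ p in strip U ρ (Ioo (t - δ) t),
        graphJac h p * χ (graphPoint h p).1.snd ∂V := by
    rw [← integral_sub i1 i2, ← integral_const_mul]
    refine abs_integral_le_integral_abs.trans (integral_mono (i1.sub i2).abs (i3.const_mul ε)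
      fun p => ?_)
    dsimp only
    rw [← mul_sub, abs_mul, abs_of_nonneg (graphJac_nonneg h p), mul_left_comm]
    exact mul_le_mul_of_nonneg_left (hαg _) (graphJac_nonneg h p)
  rw [Real.dist_eq] at h1 h2 ⊢
  have h3 : η = ε * (2 * I + 3) := by rw [hε]; field_simp
  have h4 : ε * ∫ p in strip U ρ (Ioo (t - δ) t), graphJac h p * χ (graphPoint h p).1.snd ∂V
      ≤ ε * (I + 1) := mul_le_mul_of_nonneg_left (by linarith [(abs_lt.1 h2).2]) hε0.le
  have h5 := hTd.trans h4
  rw [abs_lt] at h1 ⊢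
  rw [abs_le] at hT0 h5
  constructor <;> nlinarith [h1.1, h1.2, hT0.1, hT0.2, h5.1, h5.2]

/-! ### Assembling the three parts of the push-forward -/

theorem integral_push_emb (hU : IsOpen U) {V : Measure (E × Grass E (m + 1))}
    (hV : IsVarifold U V) (τ : ℝ)
    {α : WithLp 2 (ℝ × E) × Grass (WithLp 2 (ℝ × E)) (m + 1) → ℝ} (hα : Measurable α) :
    ∫ q, α q ∂(push (emb τ) V) = ∫ p, α (graphPoint (fun _ => τ) p) ∂V := by
  have h := integral_push_graphMap (h := fun _ => τ) hU contDiffOn_const hV hα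
  rw [show emb τ = graphMap (fun _ : E => τ) from rfl, h]
  refine integral_congr_ae (ae_of_all _ fun p => ?_)
  simp only
  rw [graphJac_of_fderiv_eq_zero (by simp), one_mul]

/-- The blow-up of a varifold along the level set of a proper function converges to the sum of
its two parts, placed at heights `0` and `1`, and the cylinder over the slice. -/
theorem varTendsto_push_blowMap (hU : IsOpen U) (hρ : ContDiffOn ℝ 1 ρ U)
    (hp : IsProperMap (U.domRestrict ρ)) (hV : IsVarifold U V)
    (ht : IsLebesguePoint (m := m) U V ρ t)
    (hlim : Tendsto (fun δ : ℝ => V (strip U ρ (Ico (t - δ) t))) (𝓝[>] 0) (𝓝 0))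
    {s : ℝ → ℝ → ℝ} (hs : ∀ δ ∈ Ioo (0 : ℝ) 1, IsRamp δ (s δ)) :
    VarTendsto (realProd U) (fun δ : ℝ => push (blowMap ρ t δ (s δ)) V) (𝓝[>] 0)
      (push (emb 0) (V.restrict (strip U ρ (Ici t)))
        + push (emb 1) (V.restrict (strip U ρ (Iio t))) + intervalProd (slice U V ρ t)) := by
  intro α hα
  have hmain := tendsto_setIntegral_blow hU hρ hp hV ht hlim hs hα
  obtain ⟨⟨W₀, hW₀⟩, -⟩ := ht
  have hW := (isSlice_slice hW₀).1
  set W := slice U V ρ t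
  obtain ⟨C, K, hC, hK, hKU, hαA⟩ := hα.isAdmissible
  have hV0 : IsVarifold U (V.restrict (strip U ρ (Ici t))) := hV.mono Measure.restrict_le_self
  have hV1 : IsVarifold U (V.restrict (strip U ρ (Iio t))) := hV.mono Measure.restrict_le_self
  have hc : ∀ τ : ℝ, ContDiffOn ℝ 1 (fun _ : E => τ) U := fun τ => contDiffOn_const
  have j0 : Integrable α (push (emb 0) (V.restrict (strip U ρ (Ici t)))) := (hV0.push_graphMap hU (hc 0)).integrable_test hα
  have j1 : Integrable α (push (emb 1) (V.restrict (strip U ρ (Iio t)))) := (hV1.push_graphMap hU (hc 1)).integrable_test hα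
  have j2 := (isVarifold_intervalProd hU hW).integrable_test hα
  have hm : ∀ {B : Set ℝ}, MeasurableSet B →
      MeasurableSet (strip U ρ B : Set (E × Grass E (m + 1))) :=
    fun hB => measurableSet_strip hU hρ.continuousOn hB
  rw [integral_add_measure (j0.add_measure j1) j2, integral_add_measure j0 j1,
    integral_push_emb hU hV0 0 hα.cont.measurable, integral_push_emb hU hV1 1 hα.cont.measurable,
    integral_intervalProd hU hW hα]
  have hconst : ∀ τ : ℝ, Integrable (fun p => α (graphPoint (fun _ : E => τ) p)) V := fun τ =>
    (hαA.integrable_graph hU (hc τ) hV hK hKU).congr (ae_of_all _ fun p => by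
      simp only
      rw [graphJac_of_fderiv_eq_zero (by simp), one_mul])
  have hunion : ∀ δ : ℝ, 0 < δ → (strip U ρ (Iic (t - δ)) ∪ strip U ρ (Ioo (t - δ) t)
      : Set (E × Grass E (m + 1))) = strip U ρ (Iio t) := fun δ hδ => by
    ext p
    simp only [strip, mem_union, mem_ofPred_eq, mem_Iic, mem_Ioo, mem_Iio, ← and_or_left]
    refine and_congr_right fun _ => ⟨?_, fun h => ?_⟩
    · rintro (h | h)
      · linarith
      · exact h.2
    · rcases le_or_gt (ρ p.1) (t - δ) with h' | h'
      · exact Or.inl h'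
      · exact Or.inr ⟨h', h⟩
  have hdisj : ∀ δ : ℝ, Disjoint (strip U ρ (Iic (t - δ)) : Set (E × Grass E (m + 1)))
      (strip U ρ (Ioo (t - δ) t)) := fun δ =>
    disjoint_left.2 fun p h1 h2 => absurd h2.2.1 (not_lt.2 h1.2)
  -- The limit places all of ρ < t at height 1, the blow-up map only ρ ≤ t - δ; the discrepancy
  -- lives on the strip, whose mass vanishes.
  have hz : Tendsto (fun δ => ∫ p in strip U ρ (Ioo (t - δ) t),
      α (graphPoint (fun _ : E => (1 : ℝ)) p) ∂V) (𝓝[>] 0) (𝓝 0) := by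
    have h1 := ((ENNReal.tendsto_toReal ENNReal.zero_ne_top).comp hlim).const_mul C
    rw [ENNReal.toReal_zero, mul_zero] at h1
    refine squeeze_zero_norm (fun δ => ?_) h1
    refine (norm_setIntegral_le_of_norm_le_const
      (measure_strip_lt_top hp hV Ioo_subset_Icc_self) fun p _ => hαA.bound _).trans ?_
    refine mul_le_mul_of_nonneg_left ?_ hC.le
    exact ENNReal.toReal_mono (measure_strip_lt_top hp hV Ico_subset_Icc_self).ne
      (measure_mono fun p hp => ⟨hp.1, Ioo_subset_Ico_self hp.2⟩)
  set A₀ := ∫ p in strip U ρ (Ici t), α (graphPoint (fun _ : E => (0 : ℝ)) p) ∂V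
  set A₁ := ∫ p in strip U ρ (Iio t), α (graphPoint (fun _ : E => (1 : ℝ)) p) ∂V
  have hlim2 := ((tendsto_const_nhds (x := A₀ + A₁)).sub hz).add hmain
  rw [sub_zero] at hlim2
  refine hlim2.congr' ?_
  filter_upwards [Ioo_mem_nhdsGT (zero_lt_one' ℝ)] with δ hδ
  have hδ0 := hδ.1
  have hcd := contDiffOn_blowFun (t := t) (hs δ hδ) hρ
  rw [blowMap_eq, integral_push_graphMap hU hcd hV hα.cont.measurable]
  have hint := hαA.integrable_graph hU hcd hV hK hKU
  set h := blowFun ρ t δ (s δ) with hh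
  -- Equality of values is not enough: the differential must vanish too, so that Jacobian and image
  -- plane agree with those of the constant map.
  have hfd : ∀ p : E × Grass E (m + 1), p.1 ∈ U → ∀ τ : ℝ, h p.1 = τ →
      deriv (s δ) ((t - ρ p.1) / δ) = 0 →
      graphJac h p * α (graphPoint h p) = α (graphPoint (fun _ : E => τ) p) := by
    intro p hpU τ h1 h2
    have h3 : fderiv ℝ h p.1 = 0 := by
      rw [hh, fderiv_blowFun hU (hs δ hδ) hρ hpU, h2]; simp
    rw [graphJac_of_fderiv_eq_zero h3, one_mul, graphPoint, graphPoint, graphMap, graphMap, h1, h3]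
    simp
  have e0 : ∫ p in strip U ρ (Ici t), graphJac h p * α (graphPoint h p) ∂V = A₀ := by
    refine setIntegral_congr_fun (hm measurableSet_Ici) fun p hp => ?_
    have hle : (t - ρ p.1) / δ ≤ 0 :=
      div_nonpos_of_nonpos_of_nonneg (sub_nonpos.2 hp.2) hδ0.le
    exact hfd p hp.1 0 ((hs δ hδ).eq_zero _ hle) ((hs δ hδ).deriv_eq_zero_of_nonpos hle)
  have e1 : ∫ p in strip U ρ (Iic (t - δ)), graphJac h p * α (graphPoint h p) ∂V
      = ∫ p in strip U ρ (Iic (t - δ)), α (graphPoint (fun _ : E => (1 : ℝ)) p) ∂V := by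
    refine setIntegral_congr_fun (hm measurableSet_Iic) fun p hp => ?_
    have hle : 1 ≤ (t - ρ p.1) / δ := by
      rw [le_div_iff₀ hδ0]
      have : ρ p.1 ≤ t - δ := hp.2
      linarith
    exact hfd p hp.1 1 ((hs δ hδ).eq_one _ hle) ((hs δ hδ).deriv_eq_zero_of_one_le hle)
  have e2 : A₁ = (∫ p in strip U ρ (Iic (t - δ)), α (graphPoint (fun _ : E => (1 : ℝ)) p) ∂V)
      + ∫ p in strip U ρ (Ioo (t - δ) t), α (graphPoint (fun _ : E => (1 : ℝ)) p) ∂V := by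
    rw [← setIntegral_union (hdisj δ) (hm measurableSet_Ioo) (hconst 1).integrableOn
      (hconst 1).integrableOn, hunion δ hδ0]
  have e3 : ∫ p, graphJac h p * α (graphPoint h p) ∂V
      = (∫ p in strip U ρ (Ici t), graphJac h p * α (graphPoint h p) ∂V)
        + ((∫ p in strip U ρ (Iic (t - δ)), graphJac h p * α (graphPoint h p) ∂V)
        + ∫ p in strip U ρ (Ioo (t - δ) t), graphJac h p * α (graphPoint h p) ∂V) := by
    rw [← setIntegral_union (hdisj δ) (hm measurableSet_Ioo) hint.integrableOn
      hint.integrableOn, hunion δ hδ0, ← setIntegral_union _ (hm measurableSet_Iio)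
      hint.integrableOn hint.integrableOn]
    · refine (setIntegral_eq_integral_of_ae_compl_eq_zero ?_).symm
      filter_upwards [hV.ae_mem] with p hpU hp
      refine absurd ?_ hp
      rcases le_or_gt t (ρ p.1) with h' | h'
      · exact Or.inl ⟨hpU, h'⟩
      · exact Or.inr ⟨hpU, h'⟩
    · exact disjoint_left.2 fun p h1 h2 =>
        (not_lt.2 (show t ≤ ρ p.1 from h1.2)) (show ρ p.1 < t from h2.2)
  rw [e3, e0, e1, e2]
  ring
end

end Vari
end

/-! ### The theorem in Euclidean space, with m = k + 1 -/

theorem mainTheorem7 {n k : ℕ} (hkn : k + 1 < n)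
    (U : Set (EuclideanSpace ℝ (Fin n))) (hU : IsOpen U)
    (V : MeasureTheory.Measure
      (EuclideanSpace ℝ (Fin n) × Grass (EuclideanSpace ℝ (Fin n)) (k + 1)))
    (hV : Vari.IsVarifold U V)
    (ρ : EuclideanSpace ℝ (Fin n) → ℝ) (hρ : ContDiffOn ℝ 1 ρ U)
    (hρ_proper : IsProperMap (U.domRestrict ρ))
    (ι t : ℝ) (hι : 0 < ι) (ht : Vari.IsLebesguePoint U V ρ t)
    (hrect : Vari.IsRectifiableVarifold U (V.restrict (Vari.strip U ρ (Set.Icc (t - ι) t))))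
    (hlim : Tendsto (fun δ : ℝ => V (Vari.strip U ρ (Set.Ico (t - δ) t))) (𝓝[>] 0) (𝓝 0))
    (s : ℝ → ℝ → ℝ) (hs : ∀ δ ∈ Set.Ioo (0 : ℝ) 1, Vari.IsRamp δ (s δ)) :
    Vari.IsVarifold (Vari.realProd U)
      (Vari.push (Vari.emb 0) (V.restrict (Vari.strip U ρ (Set.Ici t)))
        + Vari.push (Vari.emb 1) (V.restrict (Vari.strip U ρ (Set.Iio t)))
        + Vari.intervalProd (Vari.slice U V ρ t)) ∧
    (∀ δ ∈ Set.Ioo (0 : ℝ) 1,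
      Vari.IsVarifold (Vari.realProd U) (Vari.push (Vari.blowMap ρ t δ (s δ)) V)) ∧
    Vari.VarTendsto (Vari.realProd U)
      (fun δ : ℝ => Vari.push (Vari.blowMap ρ t δ (s δ)) V) (𝓝[>] 0)
      (Vari.push (Vari.emb 0) (V.restrict (Vari.strip U ρ (Set.Ici t)))
        + Vari.push (Vari.emb 1) (V.restrict (Vari.strip U ρ (Set.Iio t)))
        + Vari.intervalProd (Vari.slice U V ρ t)) := by
  -- Provides the default plane in `kerInter`; it exists because k ≤ n.
  have : Nonempty (Grass (EuclideanSpace ℝ (Fin n)) k) :=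
    Vari.Grass.nonempty_of_le (by rw [finrank_euclideanSpace_fin]; omega)
  refine ⟨?_, fun δ hδ => ?_, Vari.varTendsto_push_blowMap hU hρ hρ_proper hV ht hlim hs⟩
  · obtain ⟨⟨W, hW⟩, -⟩ := ht
    exact (((hV.mono Measure.restrict_le_self).push_graphMap hU contDiffOn_const).add
      ((hV.mono Measure.restrict_le_self).push_graphMap hU contDiffOn_const)).add
      (Vari.isVarifold_intervalProd hU (Vari.isSlice_slice hW).1)
  · exact hV.push_graphMap hU (Vari.contDiffOn_blowFun (hs δ hδ) hρ)
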